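/- Theorem (continuous dependence on the data). Let $d\ge 2$, let $\Omega\subset\mathbb R^d$ be a bounded domain with smooth boundary $\Gamma=\partial\Omega$, and let $T>0$. Put $H=L^2(\Omega)$, $V=H^1(\Omega)$, $H_\Gamma=L^2(\Gamma)$, $V_\Gamma=H^1(\Gamma)$ and $\mathcal V=\{z\in V:\ z|_\Gamma\in V_\Gamma\}$; identify $H$ and $H_\Gamma$ with their duals, so that $V\subset H\subset V^*$ and $V_\Gamma\subset H_\Gamma\subset V_\Gamma^*$. Write $Q=\Omega\times(0,T)$, $\Sigma=\Gamma\times(0,T)$, and $\nabla_\Gamma$ for the tangential gradient on $\Gamma$. Let $\nu>0$, let $\hat\beta,\hat\beta_\Gamma:\mathbb R\to[0,+\infty]$ be convex, proper and lower semicontinuous with $\hat\beta(0)=\hat\beta_\Gamma(0)=0$, let $\beta=\partial\hat\beta$ and $\beta_\Gamma=\partial\hat\beta_\Gamma$ be their subdifferentials, and let $\pi,\pi_\Gamma:\mathbb R\to\mathbb R$ be Lipschitz continuous with Lipschitz constants $L$ and $L_\Gamma$. For data $f\in L^2(0,T;H)$, $f_\Gamma\in L^2(0,T;H_\Gamma)$,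 $u_0\in H$, $v_0\in H_\Gamma$, a weak solution is a quadruplet $(u,v,\xi,\xi_\Gamma)$ such that $$u\in L^2(0,T;V)\cap H^1(0,T;V^*),\qquad v=u|_\Gamma\in L^2(0,T;V_\Gamma)\cap H^1(0,T;V_\Gamma^*),$$ $$\xi\in L^2(0,T;H),\ \ \xi\in\beta(u)\ \text{a.e. in } Q,\qquad \xi_\Gamma\in L^2(0,T;H_\Gamma),\ \ \xi_\Gamma\in\beta_\Gamma(v)\ \text{a.e. on }\Sigma,$$ $u(0)=u_0$ and $v(0)=v_0$ (for the representatives $u\in C^0([0,T];H)$ and $v\in C^0([0,T];H_\Gamma)$), and, for almost every $t\in(0,T)$ and every $z\in\mathcal V$, $$\langle\partial_t u(t),z\rangle_{V^*,V}+\int_\Omega\nabla u(t)\cdot\nabla z+\int_\Omega(\xi(t)+\pi(u(t)))z+\langle\partial_t v(t),z\rangle_{V_\Gamma^*,V_\Gamma}$$ $$+\nu\int_\Gamma\nabla_\Gamma v(t)\cdot\nabla_\Gamma z+\int_\Gamma(\xi_\Gamma(t)+\pi_\Gamma(v(t)))z=\int_\Omega f(t)z+\int_\Gamma f_\Gamma(t)z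 .$$ Then there is a constant $c$, depending only on $\Omega$, $T$, $L$ and $L_\Gamma$ (in particular not on $\nu$, on $\hat\beta,\hat\beta_\Gamma$, on the data or on the solutions), such that for any two weak solutions $(u_i,v_i,\xi_i,\xi_{\Gamma,i})$ with data $f_i,f_{\Gamma,i},u_{0,i},v_{0,i}$, $i=1,2$ (and the same $\nu,\beta,\beta_\Gamma,\pi,\pi_\Gamma$), $$\|u_1-u_2\|^2_{L^\infty(0,T;H)}+\|\nabla(u_1-u_2)\|^2_{L^2(Q)}+\|v_1-v_2\|^2_{L^\infty(0,T;H_\Gamma)}+\nu\|\nabla_\Gamma(v_1-v_2)\|^2_{L^2(\Sigma)}$$ $$\le c\,\Big\{\|u_{0,1}-u_{0,2}\|_H^2+\|v_{0,1}-v_{0,2}\|^2_{H_\Gamma}+\|f_1-f_2\|^2_{L^2(0,T;H)}+\|f_{\Gamma,1}-f_{\Gamma,2}\|^2_{L^2(0,T;H_\Gamma)}\Big\}.$$ -/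

import Mathlib

open MeasureTheory Set Filter Topology
open scoped NNReal ENNReal ContDiff

namespace AllenCahn

noncomputable section

/-! ### The domain and its boundary -/

/-- `Ω` is a bounded domain of `ℝᵈ` with smooth boundary: near every boundary point a smooth
diffeomorphism between open sets maps `Ω` to one side of a coordinate hyperplane. -/
structure IsSmoothBoundedDomain {d : ℕ} (Ω : Set (EuclideanSpace ℝ (Fin d))) : Prop where
  isOpen : IsOpen Ω
  isConnected : IsConnected Ω
  isBounded : Bornology.IsBounded Ω
  smooth_boundary : ∀ x ∈ frontier Ω,
    ∃ Φ : OpenPartialHomeomorph (EuclideanSpace ℝ (Fin d)) (EuclideanSpace ℝ (Fin d)),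
      x ∈ Φ.source ∧ ContDiffOn ℝ ∞ Φ Φ.source ∧ ContDiffOn ℝ ∞ Φ.symm Φ.target ∧
      ∃ i : Fin d, ∀ y ∈ Φ.source, (y ∈ Ω ↔ Φ y i < 0)

/-- The surface measure of `Γ = ∂Ω`: the `(d-1)`-dimensional Hausdorff measure (with the
normalization that makes it agree with area), restricted to `Γ`. -/
def surfaceMeasure {d : ℕ} (Ω : Set (EuclideanSpace ℝ (Fin d))) :
    Measure (EuclideanSpace ℝ (Fin d)) :=
  (Measure.euclideanHausdorffMeasure (d - 1)).restrict (frontier Ω)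

/-- The tangent space of `Γ = ∂Ω` at `x`, as a linear subspace of `ℝᵈ`. -/
def tangentPlane {d : ℕ} (Ω : Set (EuclideanSpace ℝ (Fin d))) (x : EuclideanSpace ℝ (Fin d)) :
    Submodule ℝ (EuclideanSpace ℝ (Fin d)) :=
  Submodule.span ℝ (tangentConeAt ℝ (frontier Ω) x)

/-- The tangential gradient `∇_Γ φ (x)` of a smooth function `φ`: the orthogonal projection
of `∇φ(x)` to the tangent space of `Γ` at `x`. -/
def tangentialGradient {d : ℕ} (Ω : Set (EuclideanSpace ℝ (Fin d)))
    (φ : EuclideanSpace ℝ (Fin d) → ℝ) (x : EuclideanSpace ℝ (Fin d)) :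
    EuclideanSpace ℝ (Fin d) :=
  (tangentPlane Ω x).starProjection (gradient φ x)

/-! ### The spaces `H`, `V`, `H_Γ`, `V_Γ`, `𝒱` -/

/-- `H = L²(Ω)`. -/
abbrev H {d : ℕ} (Ω : Set (EuclideanSpace ℝ (Fin d))) : Type :=
  Lp ℝ 2 (volume.restrict Ω)

/-- `L²(Ω; ℝᵈ)`. -/
abbrev HVec {d : ℕ} (Ω : Set (EuclideanSpace ℝ (Fin d))) : Type :=
  Lp (EuclideanSpace ℝ (Fin d)) 2 (volume.restrict Ω)

/-- `H_Γ = L²(Γ)`. -/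
abbrev HΓ {d : ℕ} (Ω : Set (EuclideanSpace ℝ (Fin d))) : Type :=
  Lp ℝ 2 (surfaceMeasure Ω)

/-- `L²(Γ; ℝᵈ)`. -/
abbrev HΓVec {d : ℕ} (Ω : Set (EuclideanSpace ℝ (Fin d))) : Type :=
  Lp (EuclideanSpace ℝ (Fin d)) 2 (surfaceMeasure Ω)

/-- `G` is the weak gradient of `w` in `Ω`. -/
def HasWeakGradient {d : ℕ} {Ω : Set (EuclideanSpace ℝ (Fin d))} (w : H Ω) (G : HVec Ω) : Prop :=
  ∀ φ : EuclideanSpace ℝ (Fin d) → ℝ, ContDiff ℝ ∞ φ → HasCompactSupport φ → tsupport φ ⊆ Ω →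
    ∫ x in Ω, w x • gradient φ x = - ∫ x in Ω, φ x • G x

theorem gradient_memLp {d : ℕ} {φ : EuclideanSpace ℝ (Fin d) → ℝ} (h : ContDiff ℝ ∞ φ)
    (hc : HasCompactSupport φ) (μ : Measure (EuclideanSpace ℝ (Fin d)))
    [IsFiniteMeasureOnCompacts μ] : MemLp (gradient φ) 2 μ := by
  have h1 : Continuous (gradient φ) :=
    (InnerProductSpace.toDual ℝ (EuclideanSpace ℝ (Fin d))).symm.continuous.comp
      (h.continuous_fderiv (by simp))
  refine h1.memLp_of_hasCompactSupport ?_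
  exact (hc.fderiv (𝕜 := ℝ)).comp_left
    (g := (InnerProductSpace.toDual ℝ (EuclideanSpace ℝ (Fin d))).symm) (map_zero _)

/-- The pairs `(w, ∇w)` of a function `w ∈ L²(Ω)` and its (unique) weak gradient
`∇w ∈ L²(Ω; ℝᵈ)`. -/
def VGraph {d : ℕ} (Ω : Set (EuclideanSpace ℝ (Fin d))) : Submodule ℝ (WithLp 2 (H Ω × HVec Ω)) where
  carrier := {w | HasWeakGradient w.fst w.snd}
  zero_mem' := by
    intro φ _ _ _
    have h1 : ∫ x in Ω, (WithLp.fst (0 : WithLp 2 (H Ω × HVec Ω))) x • gradient φ x = 0 := by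
      apply integral_eq_zero_of_ae
      filter_upwards [Lp.coeFn_zero ℝ 2 (volume.restrict Ω)] with x hx
      exact (congrArg (· • gradient φ x) hx).trans (zero_smul ℝ _)
    have h2 : ∫ x in Ω, φ x • (WithLp.snd (0 : WithLp 2 (H Ω × HVec Ω))) x = 0 := by
      apply integral_eq_zero_of_ae
      filter_upwards [Lp.coeFn_zero (EuclideanSpace ℝ (Fin d)) 2 (volume.restrict Ω)] with x hx
      exact (congrArg (φ x • ·) hx).trans (smul_zero _)
    rw [h1, h2, neg_zero]
  add_mem' := by
    intro a b ha hb φ h1 h2 h3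
    have hg := gradient_memLp h1 h2 (volume.restrict Ω)
    have hφ : MemLp φ 2 (volume.restrict Ω) := h1.continuous.memLp_of_hasCompactSupport h2
    have i1 : ∀ w : H Ω, Integrable (fun x => w x • gradient φ x) (volume.restrict Ω) :=
      fun w => memLp_one_iff_integrable.mp (hg.smul (Lp.memLp w))
    have i2 : ∀ G : HVec Ω, Integrable (fun x => φ x • G x) (volume.restrict Ω) :=
      fun G => memLp_one_iff_integrable.mp ((Lp.memLp G).smul hφ)
    have e1 : ∫ x in Ω, (a + b).fst x • gradient φ x
        = (∫ x in Ω, a.fst x • gradient φ x) + ∫ x in Ω, b.fst x • gradient φ x := by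
      rw [← integral_add (i1 _) (i1 _)]
      apply integral_congr_ae
      filter_upwards [Lp.coeFn_add a.fst b.fst] with x hx
      exact (congrArg (· • gradient φ x) hx).trans (add_smul _ _ _)
    have e2 : ∫ x in Ω, φ x • (a + b).snd x
        = (∫ x in Ω, φ x • a.snd x) + ∫ x in Ω, φ x • b.snd x := by
      rw [← integral_add (i2 _) (i2 _)]
      apply integral_congr_ae
      filter_upwards [Lp.coeFn_add a.snd b.snd] with x hx
      exact (congrArg (φ x • ·) hx).trans (smul_add _ _ _)
    rw [e1, e2, ha φ h1 h2 h3, hb φ h1 h2 h3, neg_add]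
  smul_mem' := by
    intro c a ha φ h1 h2 h3
    have e1 : ∫ x in Ω, (c • a).fst x • gradient φ x
        = c • ∫ x in Ω, a.fst x • gradient φ x := by
      rw [← integral_smul]
      apply integral_congr_ae
      filter_upwards [Lp.coeFn_smul c a.fst] with x hx
      exact (congrArg (· • gradient φ x) hx).trans (mul_smul _ _ _)
    have e2 : ∫ x in Ω, φ x • (c • a).snd x = c • ∫ x in Ω, φ x • a.snd x := by
      rw [← integral_smul]
      apply integral_congr_ae
      filter_upwards [Lp.coeFn_smul c a.snd] with x hx
      exact (congrArg (φ x • ·) hx).trans (smul_comm (φ x) c (a.snd x))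
    rw [e1, e2, ha φ h1 h2 h3, smul_neg]

/-- `V = H¹(Ω)`. An element is the pair `(w, ∇w)`, and the norm is `‖w‖_V² = ‖w‖_H² + ‖∇w‖²`. -/
def V {d : ℕ} (Ω : Set (EuclideanSpace ℝ (Fin d))) : Type := VGraph Ω

instance {d : ℕ} (Ω : Set (EuclideanSpace ℝ (Fin d))) : NormedAddCommGroup (V Ω) :=
  inferInstanceAs (NormedAddCommGroup (VGraph Ω))

instance {d : ℕ} (Ω : Set (EuclideanSpace ℝ (Fin d))) : InnerProductSpace ℝ (V Ω) :=
  inferInstanceAs (InnerProductSpace ℝ (VGraph Ω))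

/-- The pairs `(φ|_Γ, ∇_Γ φ)` with `φ` smooth. -/
def smoothSurfacePairs {d : ℕ} (Ω : Set (EuclideanSpace ℝ (Fin d))) :
    Set (WithLp 2 (HΓ Ω × HΓVec Ω)) :=
  {w | ∃ φ : EuclideanSpace ℝ (Fin d) → ℝ, ContDiff ℝ ∞ φ ∧
    w.fst =ᵐ[surfaceMeasure Ω] φ ∧ w.snd =ᵐ[surfaceMeasure Ω] tangentialGradient Ω φ}

/-- The closure of the pairs `(φ|_Γ, ∇_Γ φ)` with `φ` smooth. (The span of these pairs is the
set of these pairs itself.) -/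
def VΓGraph {d : ℕ} (Ω : Set (EuclideanSpace ℝ (Fin d))) :
    Submodule ℝ (WithLp 2 (HΓ Ω × HΓVec Ω)) :=
  (Submodule.span ℝ (smoothSurfacePairs Ω)).topologicalClosure

/-- `V_Γ = H¹(Γ)`, the completion of the smooth functions on `Γ` in the norm
`‖w‖_{V_Γ}² = ‖w‖_{H_Γ}² + ‖∇_Γ w‖²`. An element is the pair `(w, ∇_Γ w)` of a function
`w ∈ L²(Γ)` and its tangential gradient `∇_Γ w ∈ L²(Γ; ℝᵈ)`. -/
def VΓ {d : ℕ} (Ω : Set (EuclideanSpace ℝ (Fin d))) : Type := VΓGraph Ω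

instance {d : ℕ} (Ω : Set (EuclideanSpace ℝ (Fin d))) : NormedAddCommGroup (VΓ Ω) :=
  inferInstanceAs (NormedAddCommGroup (VΓGraph Ω))

instance {d : ℕ} (Ω : Set (EuclideanSpace ℝ (Fin d))) : InnerProductSpace ℝ (VΓ Ω) :=
  inferInstanceAs (InnerProductSpace ℝ (VΓGraph Ω))

/-- The inclusion `V ⊂ H`. -/
def V.toH {d : ℕ} {Ω : Set (EuclideanSpace ℝ (Fin d))} : V Ω →L[ℝ] H Ω :=
  (WithLp.fstL 2 ℝ (H Ω) (HVec Ω)).comp (VGraph Ω).subtypeL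

/-- The gradient `∇ : V → L²(Ω; ℝᵈ)`. -/
def V.grad {d : ℕ} {Ω : Set (EuclideanSpace ℝ (Fin d))} : V Ω →L[ℝ] HVec Ω :=
  (WithLp.sndL 2 ℝ (H Ω) (HVec Ω)).comp (VGraph Ω).subtypeL

/-- The inclusion `V_Γ ⊂ H_Γ`. -/
def VΓ.toH {d : ℕ} {Ω : Set (EuclideanSpace ℝ (Fin d))} : VΓ Ω →L[ℝ] HΓ Ω :=
  (WithLp.fstL 2 ℝ (HΓ Ω) (HΓVec Ω)).comp (VΓGraph Ω).subtypeL

/-- The tangential gradient `∇_Γ : V_Γ → L²(Γ; ℝᵈ)`. -/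
def VΓ.grad {d : ℕ} {Ω : Set (EuclideanSpace ℝ (Fin d))} : VΓ Ω →L[ℝ] HΓVec Ω :=
  (WithLp.sndL 2 ℝ (HΓ Ω) (HΓVec Ω)).comp (VΓGraph Ω).subtypeL

/-- The map `X → X*` induced by `i : X → Y`, where the Hilbert space `Y` is identified with its
dual: `⟨pivot i w, z⟩ = (i w, i z)_Y`. -/
def pivot {X Y : Type*} [NormedAddCommGroup X] [NormedSpace ℝ X] [NormedAddCommGroup Y]
    [InnerProductSpace ℝ Y] (i : X →L[ℝ] Y) (w : X) : StrongDual ℝ X :=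
  (innerSL ℝ (i w)).comp i

/-- The graph of the trace operator `w ↦ w|_Γ` from `V` to `H_Γ`: the closure of the set of
the pairs `(φ|_Ω, φ|_Γ)` with `φ` smooth on `ℝᵈ`. -/
def traceGraph {d : ℕ} (Ω : Set (EuclideanSpace ℝ (Fin d))) : Set (V Ω × HΓ Ω) :=
  closure {p | ∃ φ : EuclideanSpace ℝ (Fin d) → ℝ, ContDiff ℝ ∞ φ ∧
    V.toH p.1 =ᵐ[volume.restrict Ω] φ ∧ p.2 =ᵐ[surfaceMeasure Ω] φ}

/-- `𝒱 = {z ∈ V : z|_Γ ∈ V_Γ}`. An element is listed as the pair `(z, z|_Γ)`. -/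
def calV {d : ℕ} (Ω : Set (EuclideanSpace ℝ (Fin d))) : Set (V Ω × VΓ Ω) :=
  {z | (z.1, VΓ.toH z.2) ∈ traceGraph Ω}

/-! ### Functions of time -/

/-- The Lebesgue measure on the time interval `(0,T)`. -/
abbrev timeMeasure (T : ℝ) : Measure ℝ := volume.restrict (Ioo 0 T)

/-- `g ∈ L²(0,T; X)` (a strongly measurable function with square integrable norm). -/
def IsL2 {X : Type*} [NormedAddCommGroup X] (T : ℝ) (g : ℝ → X) : Prop :=
  MemLp g 2 (timeMeasure T)

/-- `g'` is the derivative of `g` in the sense of `X`-valued distributions on `(0,T)`. -/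
def HasWeakTimeDeriv {X : Type*} [NormedAddCommGroup X] [NormedSpace ℝ X] (T : ℝ)
    (g g' : ℝ → X) : Prop :=
  ∀ φ : ℝ → ℝ, ContDiff ℝ ∞ φ → HasCompactSupport φ → tsupport φ ⊆ Ioo 0 T →
    ∫ t in Ioo 0 T, deriv φ t • g t = - ∫ t in Ioo 0 T, φ t • g' t

/-- `g(0) = g₀`, where `g(0)` is the value at `0` of the representative of `g` in
`C⁰([0,T]; X)`. -/
def HasInitialValue {X : Type*} [NormedAddCommGroup X] (T : ℝ) (g : ℝ → X) (g₀ : X) : Prop :=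
  ∃ h : ℝ → X, ContinuousOn h (Icc 0 T) ∧ h =ᵐ[timeMeasure T] g ∧ h 0 = g₀

/-! ### Nonlinearities -/

/-- `b : ℝ → [0,+∞]` is convex, proper, lower semicontinuous, and `b 0 = 0` (which makes it
proper). -/
structure IsConvexPotential (b : ℝ → ℝ≥0∞) : Prop where
  convex : ConvexOn ℝ≥0 univ b
  lsc : LowerSemicontinuous b
  zero : b 0 = 0

/-- The subdifferential `∂b(r)` of a proper function `b : ℝ → [0,+∞]`. -/
def subdifferential (b : ℝ → ℝ≥0∞) (r : ℝ) : Set ℝ :=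
  {ξ | b r ≠ ⊤ ∧ ∀ s : ℝ, (b r : EReal) + ((ξ * (s - r) : ℝ) : EReal) ≤ (b s : EReal)}

/-! ### Weak solutions -/

/-- `(u, v, ξ, ξΓ)` is a weak solution on `(0,T)` of the Allen-Cahn problem
`∂ₜu - Δu + ξ + π(u) = f`, `ξ ∈ ∂b(u)` in `Ω`, with the dynamic boundary condition
`v = u|_Γ`, `∂ₙu + ∂ₜv - ν Δ_Γ v + ξΓ + πΓ(v) = fΓ`, `ξΓ ∈ ∂bΓ(v)` on `Γ` and the initial
conditions `u(0) = u₀`, `v(0) = v₀`. -/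
structure IsWeakSolution {d : ℕ} (Ω : Set (EuclideanSpace ℝ (Fin d))) (T ν : ℝ)
    (b bΓ : ℝ → ℝ≥0∞) (π πΓ : ℝ → ℝ) (f : ℝ → H Ω) (fΓ : ℝ → HΓ Ω) (u₀ : H Ω) (v₀ : HΓ Ω)
    (u : ℝ → V Ω) (v : ℝ → VΓ Ω) (ξ : ℝ → H Ω) (ξΓ : ℝ → HΓ Ω) : Prop where
  isL2_u : IsL2 T u
  isL2_v : IsL2 T v
  trace : ∀ᵐ t ∂timeMeasure T, (u t, v t) ∈ calV Ω
  isL2_ξ : IsL2 T ξ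
  ξ_mem : ∀ᵐ t ∂timeMeasure T, ∀ᵐ x ∂volume.restrict Ω, ξ t x ∈ subdifferential b (V.toH (u t) x)
  isL2_ξΓ : IsL2 T ξΓ
  ξΓ_mem : ∀ᵐ t ∂timeMeasure T, ∀ᵐ x ∂surfaceMeasure Ω,
    ξΓ t x ∈ subdifferential bΓ (VΓ.toH (v t) x)
  initial_u : HasInitialValue T (fun t => V.toH (u t)) u₀
  initial_v : HasInitialValue T (fun t => VΓ.toH (v t)) v₀
  /-- `u ∈ H¹(0,T;V*)` and `v ∈ H¹(0,T;V_Γ*)`, and the variational equality holds. -/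
  equation : ∃ (u' : ℝ → StrongDual ℝ (V Ω)) (v' : ℝ → StrongDual ℝ (VΓ Ω)),
    IsL2 T u' ∧ HasWeakTimeDeriv T (fun t => pivot V.toH (u t)) u' ∧
    IsL2 T v' ∧ HasWeakTimeDeriv T (fun t => pivot VΓ.toH (v t)) v' ∧
    ∀ᵐ t ∂timeMeasure T, ∀ z ∈ calV Ω,
      u' t z.1 + (∫ x in Ω, inner ℝ (V.grad (u t) x) (V.grad z.1 x))
        + (∫ x in Ω, (ξ t x + π (V.toH (u t) x)) * V.toH z.1 x)
        + v' t z.2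
        + ν * (∫ x, inner ℝ (VΓ.grad (v t) x) (VΓ.grad z.2 x) ∂surfaceMeasure Ω)
        + (∫ x, (ξΓ t x + πΓ (VΓ.toH (v t) x)) * VΓ.toH z.2 x ∂surfaceMeasure Ω)
      = (∫ x in Ω, f t x * V.toH z.1 x) + (∫ x, fΓ t x * VΓ.toH z.2 x ∂surfaceMeasure Ω)

end

end AllenCahn

/-!
Continuous dependence is an energy estimate. The difference of the two variational equations is
tested with `(u₁ - u₂, v₁ - v₂)`, which lies in `𝒱` because the graph of the trace is a linear
space (`calV_sub_mem`). The terms with `ξ₁ - ξ₂` and `ξΓ₁ - ξΓ₂` are nonnegative, since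
subdifferentials are monotone, and may be dropped, and the Lipschitz perturbations cost
`L ‖u₁ - u₂‖²` and `LΓ ‖v₁ - v₂‖²`; this is `dissipation_le`. Splitting the integrals over `Γ`
requires `πΓ(vᵢ) ∈ L²(Γ)`, hence a finite surface measure. It is finite because `Γ` is compact and
is locally a Lipschitz image of a bounded piece of a hyperplane
(`IsSmoothBoundedDomain.isFiniteMeasure_surfaceMeasure`).

The duality pairings `⟨∂ₜu, u⟩` are turned into time derivatives of `‖u‖² / 2` by
`energy_inequality`. Only the inequality `‖h(b)‖² - ‖h(0)‖² ≤ 2 ∫₀ᵇ ⟨g', g⟩` is needed, and it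
comes from the convexity of `‖·‖²`, which gives
`‖h(s)‖² - ‖h(s-τ)‖² ≤ 2 (h(s) - h(s-τ), h(s))`. Since a continuous function is the integral of
its weak derivative (`HasWeakTimeDeriv.sub_eq_integral`), the right-hand side is an average of
translates of `g'` paired with `g`, and translations are continuous in `L²`.

Gronwall's lemma (`energy_gronwall`) then bounds the energy and the dissipation, with a constant
that depends only on `T`, `L` and `LΓ`.
-/

namespace AllenCahn

/-! ### Functions of time with a weak derivative -/

/-- The derivative of the smooth step `r ↦ smoothTransition ((r - s) / ε)` is an approximate
Dirac mass at `s`. -/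
theorem tendsto_integral_deriv_step {E : Type*} [NormedAddCommGroup E] [NormedSpace ℝ E]
    [CompleteSpace E] {T s : ℝ} (hs : 0 < s) (hsT : s < T) {P : ℝ → E}
    (hP : ContinuousOn P (Icc 0 T)) :
    Tendsto (fun ε : ℝ => ∫ r in Ioo 0 T,
      deriv (fun r => Real.smoothTransition ((r - s) / ε)) r • P r) (𝓝[>] 0) (𝓝 (P s)) := by
  have hcont : ContinuousAt P s := hP.continuousAt (Icc_mem_nhds hs hsT)
  rw [Metric.tendsto_nhds]
  intro δ hδ
  obtain ⟨η, hη, hη'⟩ := Metric.continuousAt_iff.mp hcont (δ / 2) (by positivity)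
  have hpos : 0 < min η (T - s) := lt_min hη (by linarith)
  filter_upwards [Ioo_mem_nhdsGT hpos] with ε hε
  obtain ⟨hε0, hε1⟩ := hε
  have hεη : ε < η := hε1.trans_le (min_le_left _ _)
  have hεT : s + ε < T := by linarith [hε1.trans_le (min_le_right η (T - s))]
  set S : ℝ → ℝ := fun r => Real.smoothTransition ((r - s) / ε) with hS
  have hSd : ContDiff ℝ ∞ S :=
    Real.smoothTransition.contDiff.comp ((contDiff_id.sub contDiff_const).div_const ε)
  have hSmono : Monotone S := fun a b hab =>
    Real.smoothTransition.monotone (by gcongr)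
  have hS0 : ∀ r, r ≤ s → S r = 0 := fun r hr =>
    Real.smoothTransition.zero_of_nonpos (div_nonpos_of_nonpos_of_nonneg (by linarith) hε0.le)
  have hS1 : ∀ r, s + ε ≤ r → S r = 1 := fun r hr =>
    Real.smoothTransition.one_of_one_le ((one_le_div hε0).2 (by linarith))
  have hdnn : ∀ r, 0 ≤ deriv S r := fun r => hSmono.deriv_nonneg
  have hdcont : Continuous (deriv S) := hSd.continuous_deriv (by simp)
  have hd0 : ∀ r, r ∉ Ioc s (s + ε) → deriv S r = 0 := by
    intro r hr
    rw [mem_Ioc, not_and_or, not_lt, not_le] at hr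
    rcases hr with hr | hr
    · -- on the left of `s` the step is constant; at `s` itself it has a minimum
      have : IsLocalMin S r := Eventually.of_forall fun x => by
        rw [hS0 r hr]; exact Real.smoothTransition.nonneg _
      exact this.deriv_eq_zero
    · have : IsLocalMax S r := Eventually.of_forall fun x => by
        rw [hS1 r hr.le]; exact Real.smoothTransition.le_one _
      exact this.deriv_eq_zero
  have hsub : Ioc s (s + ε) ⊆ Ioo 0 T := fun r hr => ⟨hs.trans hr.1, hr.2.trans_lt hεT⟩
  have e1 : ∫ r in Ioo 0 T, deriv S r • P r = ∫ r in s..(s + ε), deriv S r • P r := by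
    rw [intervalIntegral.integral_of_le (by linarith)]
    exact setIntegral_eq_of_subset_of_forall_sdiff_eq_zero measurableSet_Ioo hsub
      (fun r hr => by rw [hd0 r hr.2, zero_smul])
  have hint : IntervalIntegrable (fun r => deriv S r) volume s (s + ε) :=
    hdcont.intervalIntegrable _ _
  have e3 : ∫ r in s..(s + ε), deriv S r = 1 := by
    rw [intervalIntegral.integral_deriv_eq_sub
      (fun x _ => (hSd.differentiable (by simp)).differentiableAt) hint,
      hS0 s le_rfl, hS1 _ le_rfl, sub_zero]
  have e2 : P s = ∫ r in s..(s + ε), deriv S r • P s := by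
    rw [intervalIntegral.integral_smul_const, e3, one_smul]
  have hPc : ContinuousOn P (uIcc s (s + ε)) := by
    rw [uIcc_of_le (by linarith)]
    exact hP.mono (Icc_subset_Icc hs.le hεT.le)
  rw [dist_eq_norm, e1]
  rw [e2]
  have hi1 : IntervalIntegrable (fun r => deriv S r • P r) volume s (s + ε) :=
    (hdcont.continuousOn.smul hPc).intervalIntegrable
  have hi2 : IntervalIntegrable (fun r => deriv S r • P s) volume s (s + ε) :=
    (hdcont.smul continuous_const).intervalIntegrable _ _
  rw [← intervalIntegral.integral_sub hi1 hi2]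
  refine lt_of_le_of_lt (intervalIntegral.norm_integral_le_of_norm_le
    (g := fun r => deriv S r * (δ / 2)) (by linarith) ?_ (hint.mul_const _)) ?_
  · refine ae_of_all _ fun r hr => ?_
    rw [← smul_sub, norm_smul, Real.norm_of_nonneg (hdnn r)]
    refine mul_le_mul_of_nonneg_left ?_ (hdnn r)
    rw [← dist_eq_norm]
    refine (hη' ?_).le
    rw [Real.dist_eq, abs_of_pos (by linarith [hr.1])]
    linarith [hr.2]
  · rw [intervalIntegral.integral_mul_const, e3]
    linarith

/-- A continuous function is the integral of its weak derivative. The test functions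
`smoothTransition ((r - s) / ε) - smoothTransition ((r - t) / ε)` tend to the indicator function of
`(s,t]`, and their derivatives to the difference of the Dirac masses at `s` and `t`. -/
theorem HasWeakTimeDeriv.sub_eq_integral {E : Type*} [NormedAddCommGroup E] [NormedSpace ℝ E]
    [CompleteSpace E] {T : ℝ} {P g' : ℝ → E} (hP : ContinuousOn P (Icc 0 T))
    (hg' : IntegrableOn g' (Ioo 0 T)) (hw : HasWeakTimeDeriv T P g') {s t : ℝ}
    (hs : 0 ≤ s) (hst : s ≤ t) (htT : t ≤ T) : P t - P s = ∫ r in s..t, g' r := by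
  have key : ∀ s t, 0 < s → s < t → t < T → P t - P s = ∫ r in s..t, g' r := by
    intro s t hs hst htT
    have hsT : s < T := hst.trans htT
    have h0t : 0 < t := hs.trans hst
    let F : ℝ → ℝ → ℝ → ℝ := fun a ε r => Real.smoothTransition ((r - a) / ε)
    have hF : ∀ a ε, ContDiff ℝ ∞ (F a ε) := fun a ε =>
      Real.smoothTransition.contDiff.comp ((contDiff_id.sub contDiff_const).div_const ε)
    have hFd : ∀ a ε r, DifferentiableAt ℝ (F a ε) r := fun a ε r =>
      ((hF a ε).differentiable (by simp)).differentiableAt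
    have lim1 := (tendsto_integral_deriv_step hs hsT hP).sub
      (tendsto_integral_deriv_step h0t htT hP)
    have hF0 : ∀ a ε r, 0 < ε → r ≤ a → F a ε r = 0 := fun a ε r hε hr =>
      Real.smoothTransition.zero_of_nonpos (div_nonpos_of_nonpos_of_nonneg (by linarith) hε.le)
    have hF1 : ∀ a ε r, 0 < ε → a + ε ≤ r → F a ε r = 1 := fun a ε r hε hr =>
      Real.smoothTransition.one_of_one_le ((one_le_div hε).2 (by linarith))
    have hlimF : ∀ a r, Tendsto (fun ε => F a ε r) (𝓝[>] 0) (𝓝 (if a < r then 1 else 0)) := by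
      intro a r
      refine tendsto_const_nhds.congr' ?_
      split_ifs with har
      · filter_upwards [Ioo_mem_nhdsGT (sub_pos.2 har)] with ε hε
        exact (hF1 a ε r hε.1 (by linarith [hε.2])).symm
      · filter_upwards [self_mem_nhdsWithin] with ε hε
        exact (hF0 a ε r hε (not_lt.1 har)).symm
    have lim2 : Tendsto (fun ε => ∫ r in Ioo 0 T, (F s ε r - F t ε r) • g' r) (𝓝[>] 0)
        (𝓝 (∫ r in Ioo 0 T,
          ((if s < r then 1 else 0) - (if t < r then 1 else 0) : ℝ) • g' r)) := by
      refine tendsto_integral_filter_of_dominated_convergence (fun r => ‖g' r‖) ?_ ?_ hg'.norm ?_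
      · exact Eventually.of_forall fun ε =>
          ((hF s ε).continuous.sub (hF t ε).continuous).aestronglyMeasurable.smul hg'.1
      · refine Eventually.of_forall fun ε => ae_of_all _ fun r => ?_
        rw [norm_smul]
        refine mul_le_of_le_one_left (norm_nonneg _) ?_
        rw [Real.norm_eq_abs, abs_le]
        have h1 := Real.smoothTransition.nonneg ((r - s) / ε)
        have h2 := Real.smoothTransition.nonneg ((r - t) / ε)
        have h3 := Real.smoothTransition.le_one ((r - s) / ε)
        have h4 := Real.smoothTransition.le_one ((r - t) / ε)
        constructor <;> simp only [F] <;> linarith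
      · exact ae_of_all _ fun r => ((hlimF s r).sub (hlimF t r)).smul_const _
    have e2 : ∫ r in Ioo 0 T,
        ((if s < r then 1 else 0) - (if t < r then 1 else 0) : ℝ) • g' r = ∫ r in s..t, g' r := by
      have hsub : Ioc s t ⊆ Ioo 0 T := fun r hr => ⟨hs.trans hr.1, hr.2.trans_lt htT⟩
      rw [intervalIntegral.integral_of_le hst.le]
      rw [setIntegral_eq_of_subset_of_forall_sdiff_eq_zero measurableSet_Ioo hsub]
      · refine setIntegral_congr_fun measurableSet_Ioc fun r hr => ?_
        simp [hr.1, not_lt.2 hr.2]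
      · intro r hr
        have := hr.2
        rw [mem_Ioc, not_and_or, not_lt, not_le] at this
        rcases this with h | h
        · simp [not_lt.2 h, not_lt.2 (h.trans hst.le)]
        · simp [h, hst.trans h]
    rw [e2] at lim2
    have heq : ∀ᶠ ε in 𝓝[>] (0 : ℝ),
        ((∫ r in Ioo 0 T, deriv (fun r => Real.smoothTransition ((r - s) / ε)) r • P r)
          - ∫ r in Ioo 0 T, deriv (fun r => Real.smoothTransition ((r - t) / ε)) r • P r)
        = - ∫ r in Ioo 0 T, (F s ε r - F t ε r) • g' r := by
      filter_upwards [Ioo_mem_nhdsGT (sub_pos.2 htT)] with ε hε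
      have hts : tsupport (fun r => F s ε r - F t ε r) ⊆ Icc s (t + ε) := by
        refine closure_minimal (fun r hr => ?_) isClosed_Icc
        by_contra hr'
        apply hr
        rw [mem_Icc, not_and_or, not_le, not_le] at hr'
        rcases hr' with h | h
        · change F s ε r - F t ε r = 0
          rw [hF0 s ε r hε.1 h.le, hF0 t ε r hε.1 (h.le.trans hst.le), sub_zero]
        · change F s ε r - F t ε r = 0
          rw [hF1 s ε r hε.1 (by linarith), hF1 t ε r hε.1 h.le, sub_self]
      have hcs : HasCompactSupport (fun r => F s ε r - F t ε r) :=
        isCompact_Icc.of_isClosed_subset (isClosed_tsupport _) hts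
      have := hw (fun r => F s ε r - F t ε r) ((hF s ε).sub (hF t ε)) hcs
        (hts.trans fun r hr => ⟨hs.trans_le hr.1, hr.2.trans_lt (by linarith [hε.2])⟩)
      rw [← this]
      have hi : ∀ a, IntegrableOn (fun r => deriv (F a ε) r • P r) (Ioo 0 T) := fun a =>
        ((((hF a ε).continuous_deriv (by simp)).continuousOn.smul hP).integrableOn_Icc).mono_set
          Ioo_subset_Icc_self
      rw [← integral_sub (hi s) (hi t)]
      refine setIntegral_congr_fun measurableSet_Ioo fun r _ => ?_
      rw [deriv_fun_sub (hFd s ε r) (hFd t ε r), sub_smul]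
    have := tendsto_nhds_unique (lim1.congr' heq) lim2.neg
    rw [← neg_sub, this, neg_neg]
  -- the end points `0` and `T` are reached by continuity
  have hI : IntegrableOn g' (Icc 0 T) := (integrableOn_Icc_iff_integrableOn_Ioo (f := g')).2 hg'
  have hT : (0 : ℝ) ≤ T := hs.trans (hst.trans htT)
  have hii : ∀ a b, a ∈ Icc 0 T → b ∈ Icc 0 T → IntervalIntegrable g' volume a b :=
    fun a b ha hb => (intervalIntegrable_iff_integrableOn_Icc_of_le hT).2 hI |>.mono_set (by
      rw [uIcc_of_le hT]; exact uIcc_subset_Icc ha hb)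
  rcases hT.eq_or_lt with hT0 | hT0
  · have h1 : s = t := by linarith
    simp [h1]
  let D : ℝ → E := fun t => P t - ∫ r in (0 : ℝ)..t, g' r
  have hD : ContinuousOn D (Icc 0 T) := by
    refine hP.sub ?_
    have := intervalIntegral.continuousOn_primitive_interval (f := g') (μ := volume)
      (a := 0) (b := T) (by rwa [uIcc_of_le hT])
    rwa [uIcc_of_le hT] at this
  have hDc : ∀ x ∈ Ioo 0 T, ∀ y ∈ Ioo 0 T, D x = D y := by
    have aux : ∀ x ∈ Ioo 0 T, ∀ y ∈ Ioo 0 T, x < y → D x = D y := by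
      intro x hx y hy hxy
      have h1 := key x y hx.1 hxy hy.2
      have h2 := intervalIntegral.integral_interval_sub_left
        (hii 0 y (left_mem_Icc.2 hT) (Ioo_subset_Icc_self hy))
        (hii 0 x (left_mem_Icc.2 hT) (Ioo_subset_Icc_self hx))
      rw [← h2] at h1
      change P x - _ = P y - _
      rw [sub_eq_sub_iff_sub_eq_sub, ← neg_sub (P y), h1, neg_sub]
    intro x hx y hy
    rcases lt_trichotomy x y with h | h | h
    · exact aux x hx y hy h
    · rw [h]
    · exact (aux y hy x hx h).symm
  have hDcc : ∀ x ∈ Icc 0 T, D x = D (T / 2) := by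
    have hmid : T / 2 ∈ Ioo 0 T := ⟨by linarith, by linarith⟩
    have : EqOn D (fun _ => D (T / 2)) (closure (Ioo 0 T)) :=
      EqOn.of_subset_closure (s := Ioo 0 T) (fun x hx => hDc x hx _ hmid)
        (by rwa [closure_Ioo hT0.ne]) continuousOn_const subset_closure le_rfl
    rwa [closure_Ioo hT0.ne] at this
  have hsm : s ∈ Icc 0 T := ⟨hs, hst.trans htT⟩
  have htm : t ∈ Icc 0 T := ⟨hs.trans hst, htT⟩
  have h1 : D s = D t := (hDcc s hsm).trans (hDcc t htm).symm
  have h2 := intervalIntegral.integral_interval_sub_left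
    (hii 0 t (left_mem_Icc.2 hT) htm) (hii 0 s (left_mem_Icc.2 hT) hsm)
  rw [← h2]
  change P s - _ = P t - _ at h1
  rw [sub_eq_sub_iff_sub_eq_sub] at h1
  rw [← neg_sub, h1, neg_sub]

/-- The correlation `σ ↦ ∫ ⟨F(s - σ), g(s)⟩ ds` of two square integrable functions is continuous,
because translations act continuously on `L²(ℝ)`. -/
theorem continuous_integral_translate_apply {X : Type*} [NormedAddCommGroup X] [NormedSpace ℝ X]
    {F : ℝ → StrongDual ℝ X} {g : ℝ → X} (hF : MemLp F 2) (hg : MemLp g 2) :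
    Continuous fun σ : ℝ => ∫ s, F (s - σ) (g s) := by
  let B : StrongDual ℝ X →L[ℝ] X →L[ℝ] ℝ := ContinuousLinearMap.id ℝ _
  have : Fact ((2 : ℝ≥0∞) ≠ ⊤) := ⟨by norm_num⟩
  have h1 : Continuous fun σ : ℝ => B.lpPairing volume 2 2 (DomAddAct.mk (-σ) +ᵥ hF.toLp F)
      (hg.toLp g) := by
    have : Continuous fun σ : ℝ => DomAddAct.mk (-σ) +ᵥ hF.toLp F :=
      (DomAddAct.mkHomeomorph.continuous.comp continuous_neg).vadd continuous_const
    exact ((B.lpPairing volume 2 2).flip (hg.toLp g)).continuous.comp this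
  convert h1 using 2 with σ
  rw [ContinuousLinearMap.lpPairing_eq_integral]
  apply integral_congr_ae
  rw [DomAddAct.mk_vadd_toLp]
  filter_upwards [hg.coeFn_toLp,
    (hF.comp_measurePreserving (measurePreserving_vadd (-σ) volume)).coeFn_toLp] with s h2 h3
  rw [h2]
  erw [h3]
  simp [B, vadd_eq_add, sub_eq_neg_add]

/-- The joint integrability behind the exchange of the integrals over `s` and `σ`. -/
theorem integrable_translate_apply {X : Type*} [NormedAddCommGroup X] [NormedSpace ℝ X]
    {F : ℝ → StrongDual ℝ X} {g : ℝ → X} (hF : MemLp F 2) (hg : MemLp g 2) (τ : ℝ) :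
    Integrable (fun p : ℝ × ℝ => F (p.2 - p.1) (g p.2))
      ((volume.restrict (Ioc 0 τ)).prod volume) := by
  have hmp := measurePreserving_prod_neg_add (volume.restrict (Ioc 0 τ)) (volume : Measure ℝ)
  have q2 : Measure.QuasiMeasurePreserving (Prod.snd : ℝ × ℝ → ℝ)
      ((volume.restrict (Ioc 0 τ)).prod volume) volume := Measure.quasiMeasurePreserving_snd
  have mF : AEStronglyMeasurable (fun p : ℝ × ℝ => F (p.2 - p.1))
      ((volume.restrict (Ioc 0 τ)).prod volume) := by
    have := (hF.1.comp_quasiMeasurePreserving q2).comp_measurePreserving hmp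
    simpa [Function.comp_def, sub_eq_neg_add] using this
  have mg : AEStronglyMeasurable (fun p : ℝ × ℝ => g p.2)
      ((volume.restrict (Ioc 0 τ)).prod volume) := hg.1.comp_quasiMeasurePreserving q2
  have iF : Integrable (fun p : ℝ × ℝ => ‖F (p.2 - p.1)‖ ^ 2)
      ((volume.restrict (Ioc 0 τ)).prod volume) := by
    have h := (hF.integrable_norm_pow (by norm_num)).comp_snd (volume.restrict (Ioc 0 τ))
    have := hmp.integrable_comp_of_integrable h
    simpa [Function.comp_def, sub_eq_neg_add] using this
  have ig : Integrable (fun p : ℝ × ℝ => ‖g p.2‖ ^ 2)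
      ((volume.restrict (Ioc 0 τ)).prod volume) := by
    simpa using (hg.integrable_norm_pow (by norm_num)).comp_snd (volume.restrict (Ioc 0 τ))
  refine (iF.add ig).mono'
    ((ContinuousLinearMap.id ℝ (StrongDual ℝ X)).aestronglyMeasurable_comp₂ mF mg) ?_
  refine ae_of_all _ fun p => ((F (p.2 - p.1)).le_opNorm (g p.2)).trans ?_
  change _ ≤ ‖F (p.2 - p.1)‖ ^ 2 + ‖g p.2‖ ^ 2
  nlinarith [sq_nonneg (‖F (p.2 - p.1)‖ - ‖g p.2‖), sq_nonneg ‖F (p.2 - p.1)‖, sq_nonneg ‖g p.2‖]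

theorem IsL2.exists_extension {E : Type*} [NormedAddCommGroup E] {T : ℝ} {g : ℝ → E}
    (hg : IsL2 T g) : ∃ G : ℝ → E, MemLp G 2 ∧ Integrable G ∧ (∀ t ∈ Ioo 0 T, G t = g t) ∧
      ∀ t ∉ Ioo 0 T, G t = 0 :=
  ⟨(Ioo 0 T).indicator g, (memLp_indicator_iff_restrict measurableSet_Ioo).2 hg,
    (integrable_indicator_iff measurableSet_Ioo).2 (hg.integrable (by norm_num)),
    fun _ ht => indicator_of_mem ht g, fun _ ht => indicator_of_notMem ht g⟩

/-- The energy inequality in a Hilbert triple `X ⊂ Y ⊂ X*`: if `g ∈ L²(0,T;X)` has the weak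
derivative `g' ∈ L²(0,T;X*)` and `h` is its representative in `C⁰([0,T];Y)`, then
`‖h(b)‖² - ‖h(0)‖² ≤ 2 ∫₀ᵇ ⟨g', g⟩`. It rests on
`‖h(s)‖² - ‖h(s-τ)‖² ≤ 2 (h(s) - h(s-τ), h(s)) = 2 ∫₀^τ ⟨g'(s-σ), g(s)⟩ dσ`,
which is integrated over `s ∈ (0,b)` and divided by `τ → 0`. -/
theorem energy_inequality {X Y : Type*} [NormedAddCommGroup X] [NormedSpace ℝ X]
    [NormedAddCommGroup Y] [InnerProductSpace ℝ Y] (i : X →L[ℝ] Y) {T : ℝ} {g : ℝ → X}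
    {g' : ℝ → StrongDual ℝ X} (hg : IsL2 T g) (hg' : IsL2 T g')
    (hw : HasWeakTimeDeriv T (fun t => pivot i (g t)) g') {h : ℝ → Y}
    (hh : ContinuousOn h (Icc 0 T)) (hgh : h =ᵐ[timeMeasure T] fun t => i (g t)) {b : ℝ}
    (hb : b ∈ Ioc 0 T) : ‖h b‖ ^ 2 ≤ ‖h 0‖ ^ 2 + 2 * ∫ t in Ioo 0 b, g' t (g t) := by
  obtain ⟨hb0, hbT⟩ := hb
  have hT : 0 ≤ T := hb0.le.trans hbT
  -- `q y = (y, i ·)_Y` extends `pivot i` to all of `Y`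
  let q : Y →L[ℝ] StrongDual ℝ X :=
    ((ContinuousLinearMap.compL ℝ X Y ℝ).flip i).comp (innerSL ℝ)
  have hq : ∀ y x, q y x = inner ℝ y (i x) := fun y x => rfl
  have hPc : ContinuousOn (fun t => q (h t)) (Icc 0 T) := q.continuous.comp_continuousOn hh
  have hw' : HasWeakTimeDeriv T (fun t => q (h t)) g' := by
    intro φ h1 h2 h3
    rw [← hw φ h1 h2 h3]
    apply integral_congr_ae
    filter_upwards [hgh] with t ht
    rw [ht]
    rfl
  have hg'i : IntegrableOn g' (Ioo 0 T) := hg'.integrable (by norm_num)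
  -- extend `g'` from `(0,T)` and `g` from `(0,b)` by zero, and `h` by constants
  obtain ⟨G, hGL, hGi, hG, hG0⟩ := hg'.exists_extension
  have hgb : IsL2 b g := hg.mono_measure (Measure.restrict_mono (Ioo_subset_Ioo_right hbT) le_rfl)
  obtain ⟨k, hkL, -, hk, hk0⟩ := hgb.exists_extension
  let w : ℝ → Y := IccExtend hT ((Icc 0 T).domRestrict h)
  have hwc : Continuous w := hh.domRestrict.Icc_extend'
  have hw_eq : ∀ t ∈ Icc 0 T, w t = h t := fun t ht => IccExtend_of_mem hT _ ht
  have hw_neg : ∀ t ≤ 0, w t = h 0 := fun t ht => by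
    rw [← hw_eq 0 (left_mem_Icc.2 hT)]
    simp only [w]
    rw [IccExtend_of_le_left hT _ ht, IccExtend_of_le_left hT _ le_rfl]
  have hinc0 : ∀ a s, 0 ≤ a → a ≤ s → s ≤ T → q (w s) - q (w a) = ∫ r in a..s, G r := by
    intro a s ha has hsT
    rw [hw_eq s ⟨ha.trans has, hsT⟩, hw_eq a ⟨ha, has.trans hsT⟩,
      hw'.sub_eq_integral hPc hg'i ha has hsT]
    rw [intervalIntegral.integral_of_le has, intervalIntegral.integral_of_le has,
      integral_Ioc_eq_integral_Ioo, integral_Ioc_eq_integral_Ioo]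
    exact setIntegral_congr_fun measurableSet_Ioo fun r hr =>
      (hG r ⟨ha.trans_lt hr.1, hr.2.trans_le hsT⟩).symm
  have hinc : ∀ s τ, 0 ≤ s → s ≤ T → 0 ≤ τ →
      q (w s) - q (w (s - τ)) = ∫ σ in (0 : ℝ)..τ, G (s - σ) := by
    intro s τ hs hsT hτ
    rw [intervalIntegral.integral_comp_sub_left (fun r => G r) s, sub_zero]
    rcases le_total 0 (s - τ) with h0 | h0
    · exact hinc0 _ _ h0 (by linarith) hsT
    · rw [← intervalIntegral.integral_add_adjacent_intervals (b := 0)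
        hGi.intervalIntegrable hGi.intervalIntegrable, ← hinc0 0 s le_rfl hs hsT,
        hw_neg _ h0, hw_neg 0 le_rfl]
      rw [intervalIntegral.integral_of_le h0, setIntegral_eq_zero_of_forall_eq_zero, zero_add]
      intro r hr
      exact hG0 r fun hr' => (hr.2.trans_lt hr'.1).false
  let A : ℝ → ℝ := fun σ => ∫ s, G (s - σ) (k s)
  have hAc : Continuous A := continuous_integral_translate_apply hGL hkL
  let ψ : ℝ → ℝ := fun t => ‖w t‖ ^ 2
  have hψc : Continuous ψ := hwc.norm.pow 2
  have hψi : ∀ a c, IntervalIntegrable ψ volume a c := fun a c => hψc.intervalIntegrable a c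
  have hgh' : ∀ᵐ s ∂volume.restrict (Ioo 0 b), h s = i (g s) :=
    ae_mono (Measure.restrict_mono (Ioo_subset_Ioo_right hbT) le_rfl) hgh
  have hψi' : ∀ τ a c, IntervalIntegrable (fun s => ψ (s - τ)) volume a c := fun τ a c =>
    (hψc.comp (continuous_sub_right τ)).intervalIntegrable a c
  have main : ∀ τ, 0 ≤ τ →
      (∫ s in (b - τ)..b, ψ s) - τ * ‖h 0‖ ^ 2 ≤ 2 * ∫ σ in (0 : ℝ)..τ, A σ := by
    intro τ hτ
    have hint := integrable_translate_apply hGL hkL τ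
    have e1 : ∫ σ in (0 : ℝ)..τ, A σ = ∫ s, ∫ σ in (0 : ℝ)..τ, G (s - σ) (k s) := by
      simp only [intervalIntegral.integral_of_le hτ]
      exact integral_integral_swap hint
    have hint2 : Integrable (fun s => ∫ σ in (0 : ℝ)..τ, G (s - σ) (k s)) := by
      simp only [intervalIntegral.integral_of_le hτ]
      exact hint.integral_prod_right
    have e2 : (∫ s in (b - τ)..b, ψ s) - τ * ‖h 0‖ ^ 2
        = ∫ s in Ioo 0 b, (ψ s - ψ (s - τ)) := by
      have e3 : ∫ s in (-τ)..0, ψ s = τ * ‖h 0‖ ^ 2 := by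
        have : ∫ s in (-τ)..0, ψ s = ∫ s in (-τ)..0, ‖h 0‖ ^ 2 :=
          intervalIntegral.integral_congr fun s hs => by
            rw [uIcc_of_le (by linarith)] at hs
            simp only [ψ, hw_neg s hs.2]
        rw [this]
        simp
      rw [← integral_Ioc_eq_integral_Ioo, ← intervalIntegral.integral_of_le hb0.le,
        intervalIntegral.integral_sub (hψi _ _) (hψi' τ _ _),
        intervalIntegral.integral_comp_sub_right (fun s => ψ s) τ, zero_sub, ← e3,
        ← intervalIntegral.integral_add_adjacent_intervals (hψi (-τ) 0) (hψi 0 (b - τ)),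
        ← intervalIntegral.integral_add_adjacent_intervals (hψi 0 (b - τ)) (hψi (b - τ) b)]
      ring
    have e4 : ∫ s, ∫ σ in (0 : ℝ)..τ, G (s - σ) (k s)
        = ∫ s in Ioo 0 b, ∫ σ in (0 : ℝ)..τ, G (s - σ) (k s) := by
      refine (setIntegral_eq_integral_of_forall_compl_eq_zero fun s hs => ?_).symm
      simp [hk0 s hs]
    rw [e1, e2, e4, ← integral_const_mul]
    refine setIntegral_mono_on_ae ?_ (hint2.integrableOn.const_mul 2) measurableSet_Ioo ?_
    · exact ((hψc.sub (hψc.comp (continuous_sub_right τ))).integrableOn_Icc).mono_set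
        Ioo_subset_Icc_self
    · filter_upwards [(ae_restrict_iff' measurableSet_Ioo).1 hgh'] with s hs hsb
      have hsT : s ≤ T := hsb.2.le.trans hbT
      have hks : k s = g s := hk s hsb
      have hGs : IntervalIntegrable (fun σ => G (s - σ)) volume 0 τ :=
        (hGi.comp_sub_left s).intervalIntegrable
      have e5 : ∫ σ in (0 : ℝ)..τ, G (s - σ) (k s) = inner ℝ (w s - w (s - τ)) (w s) := by
        rw [← ContinuousLinearMap.intervalIntegral_apply hGs, ← hinc s τ hsb.1.le hsT hτ, hks,
          ← map_sub, hq, ← hs hsb, hw_eq s ⟨hsb.1.le, hsT⟩]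
      rw [e5]
      -- `‖x‖² - ‖y‖² ≤ 2 (x - y, x)`
      have e6 := norm_sub_sq_real (w s) (w (s - τ))
      have e7 : inner ℝ (w s - w (s - τ)) (w s) = ‖w s‖ ^ 2 - inner ℝ (w s) (w (s - τ)) := by
        rw [inner_sub_left, real_inner_self_eq_norm_sq, real_inner_comm]
      simp only [ψ]
      rw [e7]
      nlinarith [sq_nonneg ‖w s - w (s - τ)‖]
  -- compare the right derivatives at `τ = 0` of both sides
  have d1 : HasDerivAt (fun τ : ℝ => ∫ s in (b - τ)..b, ψ s) (ψ b) 0 := by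
    have h1 : HasDerivAt (fun x => ∫ s in x..b, ψ s) (-ψ (b - 0)) (b - 0) :=
      intervalIntegral.integral_hasDerivAt_left (hψi _ _)
        hψc.stronglyMeasurable.stronglyMeasurableAtFilter hψc.continuousAt
    have := h1.comp_const_sub b 0
    simpa using this
  have d2 : HasDerivAt (fun τ : ℝ => ∫ σ in (0 : ℝ)..τ, A σ) (A 0) 0 :=
    intervalIntegral.integral_hasDerivAt_right (hAc.intervalIntegrable _ _)
      hAc.stronglyMeasurable.stronglyMeasurableAtFilter hAc.continuousAt
  have d3 := ((d2.const_mul 2).sub (d1.sub ((hasDerivAt_id (0 : ℝ)).mul_const (‖h 0‖ ^ 2))))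
  have d4 := d3.tendsto_slope_zero_right
  have d5 : 0 ≤ 2 * A 0 - (ψ b - 1 * ‖h 0‖ ^ 2) := by
    refine ge_of_tendsto d4 ?_
    filter_upwards [self_mem_nhdsWithin] with τ hτ
    have hτ' : (0 : ℝ) < τ := hτ
    have := main τ hτ'.le
    simp only [Pi.sub_apply, zero_add, id, smul_eq_mul, sub_zero, zero_mul,
      intervalIntegral.integral_same, mul_zero]
    exact mul_nonneg (inv_nonneg.2 hτ'.le) (by linarith)
  have e8 : A 0 = ∫ t in Ioo 0 b, g' t (g t) := by
    simp only [A, sub_zero]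
    rw [← integral_indicator measurableSet_Ioo]
    congr 1
    ext s
    by_cases hs : s ∈ Ioo 0 b
    · simp only [indicator_of_mem hs, hk s hs, hG s (Ioo_subset_Ioo_right hbT hs)]
    · simp only [indicator_of_notMem hs, hk0 s hs, map_zero]
  rw [e8] at d5
  simp only [ψ, hw_eq b ⟨hb0.le, hbT⟩] at d5
  linarith

/-- Gronwall's inequality in integral form. -/
theorem le_mul_exp_of_le_add_integral {y : ℝ → ℝ} {T A K : ℝ} (hy : ContinuousOn y (Icc 0 T))
    (hK : 0 ≤ K) (hle : ∀ t ∈ Icc 0 T, y t ≤ A + K * ∫ s in (0 : ℝ)..t, y s) :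
    ∀ t ∈ Icc 0 T, y t ≤ A * Real.exp (K * t) := by
  intro t ht
  have hT : 0 ≤ T := ht.1.trans ht.2
  let z : ℝ → ℝ := IccExtend hT ((Icc 0 T).domRestrict y)
  have hz : Continuous z := hy.domRestrict.Icc_extend'
  have hzy : ∀ s ∈ Icc 0 T, z s = y s := fun s hs => IccExtend_of_mem hT _ hs
  let Y : ℝ → ℝ := fun t => A + K * ∫ s in (0 : ℝ)..t, z s
  have hYd : ∀ t, HasDerivAt Y (K * z t) t := fun t =>
    ((hz.integral_hasStrictDerivAt 0 t).hasDerivAt.const_mul K).const_add A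
  have hyY : ∀ t ∈ Icc 0 T, z t ≤ Y t := by
    intro t ht
    rw [hzy t ht]
    refine (hle t ht).trans_eq ?_
    congr 2
    refine intervalIntegral.integral_congr fun s hs => (hzy s ?_).symm
    rw [uIcc_of_le ht.1] at hs
    exact ⟨hs.1, hs.2.trans ht.2⟩
  have := le_gronwallBound_of_liminf_deriv_right_le (f := Y) (f' := fun t => K * z t) (δ := A)
    (K := K) (ε := 0) (a := 0) (b := T)
    (fun t _ => (hYd t).continuousAt.continuousWithinAt)
    (fun t _ r hr => (hYd t).hasDerivWithinAt.liminf_right_slope_le hr)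
    (by simp [Y]) (fun t ht => by
      rw [add_zero]
      exact mul_le_mul_of_nonneg_left (hyY t ⟨ht.1, ht.2.le⟩) hK) t ht
  rw [gronwallBound_ε0, sub_zero] at this
  rw [← hzy t ht]
  exact (hyY t ht).trans this

/-! ### The surface measure is finite -/

theorem hausdorffMeasure_hyperplane_inter_ball_lt_top {n : ℕ} (i : Fin (n + 1)) (R : ℝ) :
    μH[n] ({y : EuclideanSpace ℝ (Fin (n + 1)) | y i = 0} ∩ Metric.closedBall 0 R) < ⊤ := by
  -- the hyperplane is the range of a linear map from `ℝⁿ`, where `μH[n]` is the volume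
  let l : (Fin n → ℝ) →ₗ[ℝ] EuclideanSpace ℝ (Fin (n + 1)) :=
    { toFun := fun x => WithLp.toLp 2 (i.insertNth 0 x)
      map_add' := fun x y => by
        ext j
        refine Fin.succAboveCases i ?_ (fun j => ?_) j <;> simp
      map_smul' := fun c x => by
        ext j
        refine Fin.succAboveCases i ?_ (fun j => ?_) j <;> simp }
  have hsub : ({y : EuclideanSpace ℝ (Fin (n + 1)) | y i = 0} ∩ Metric.closedBall 0 R)
      ⊆ l.toContinuousLinearMap '' Metric.closedBall 0 R := by
    rintro y ⟨hy, hyR⟩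
    have hy' : y i = 0 := hy
    rw [mem_closedBall_zero_iff] at hyR
    refine ⟨fun j => y (i.succAbove j), ?_, ?_⟩
    · rw [mem_closedBall_zero_iff]
      refine (pi_norm_le_iff_of_nonneg ((norm_nonneg y).trans hyR)).2 fun j => ?_
      exact (PiLp.norm_apply_le y _).trans hyR
    · ext j
      change (i.insertNth 0 (fun j => y (i.succAbove j)) : Fin (n + 1) → ℝ) j = y j
      refine Fin.succAboveCases i ?_ (fun j => ?_) j
      · simp [hy']
      · simp
  refine (measure_mono hsub).trans_lt ?_
  refine (l.toContinuousLinearMap.lipschitz.hausdorffMeasure_image_le n.cast_nonneg _).trans_lt ?_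
  refine ENNReal.mul_lt_top (by simp) ?_
  have : (μH[n] : Measure (Fin n → ℝ)) = volume := by
    have := hausdorffMeasure_pi_real (ι := Fin n)
    rwa [Fintype.card_fin] at this
  rw [this]
  exact Metric.isBounded_closedBall.measure_lt_top

theorem IsSmoothBoundedDomain.isFiniteMeasure_surfaceMeasure {d : ℕ} (hd : 1 < d)
    {Ω : Set (EuclideanSpace ℝ (Fin d))} (hΩ : IsSmoothBoundedDomain Ω) :
    IsFiniteMeasure (surfaceMeasure Ω) := by
  obtain ⟨n, rfl⟩ : ∃ n, d = n + 1 := ⟨d - 1, by omega⟩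
  refine ⟨?_⟩
  have hcompact : IsCompact (frontier Ω) :=
    Metric.isCompact_of_isClosed_isBounded isClosed_frontier
      (hΩ.isBounded.closure.subset frontier_subset_closure)
  rw [surfaceMeasure, Measure.restrict_apply_univ, Measure.euclideanHausdorffMeasure_def,
    Measure.smul_apply, Nat.add_sub_cancel]
  refine ENNReal.mul_lt_top (by simp) ?_
  refine hcompact.measure_lt_top_of_nhdsWithin fun x hx => ?_
  obtain ⟨Φ, hxs, hΦ, hΦs, i, hi⟩ := hΩ.smooth_boundary x hx
  have hxt : Φ x ∈ Φ.target := Φ.map_source hxs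
  -- in the chart, boundary points lie on the hyperplane
  have hzero : ∀ y ∈ Φ.source, y ∈ frontier Ω → Φ y i = 0 := by
    intro y hys hy
    rw [hΩ.isOpen.frontier_eq] at hy
    refine le_antisymm (not_lt.1 fun hpos => ?_) (not_lt.1 fun hneg => hy.2 ((hi y hys).2 hneg))
    have hc : ContinuousAt (fun z => Φ z i) y :=
      (PiLp.continuous_apply 2 _ i).continuousAt.comp (Φ.continuousAt hys)
    have h1 : ∀ᶠ z in 𝓝 y, z ∉ Ω := by
      filter_upwards [Φ.open_source.mem_nhds hys, hc.eventually (lt_mem_nhds hpos)] with z hz hz'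
      rw [hi z hz]
      exact not_lt.2 hz'.le
    obtain ⟨z, hz, hz'⟩ := (mem_closure_iff_frequently.1 hy.1).and_eventually h1 |>.exists
    exact hz' hz
  obtain ⟨K, s, hs, hK⟩ :=
    ((hΦs.contDiffAt (Φ.open_target.mem_nhds hxt)).of_le
      (by simp)).exists_lipschitzOnWith
  let B : Set (EuclideanSpace ℝ (Fin (n + 1))) :=
    {y | y i = 0} ∩ Metric.closedBall 0 (‖Φ x‖ + 1)
  refine ⟨frontier Ω ∩ (Φ.source ∩ Φ ⁻¹' (s ∩ Metric.ball 0 (‖Φ x‖ + 1))), ?_, ?_⟩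
  · refine inter_mem self_mem_nhdsWithin (mem_nhdsWithin_of_mem_nhds ?_)
    refine inter_mem (Φ.open_source.mem_nhds hxs) ((Φ.continuousAt hxs) (inter_mem hs ?_))
    exact Metric.isOpen_ball.mem_nhds (by simp)
  · have hsub : frontier Ω ∩ (Φ.source ∩ Φ ⁻¹' (s ∩ Metric.ball 0 (‖Φ x‖ + 1)))
        ⊆ Φ.symm '' (s ∩ B) := fun y hy =>
      ⟨Φ y, ⟨hy.2.2.1, hzero y hy.2.1 hy.1, Metric.ball_subset_closedBall hy.2.2.2⟩,
        Φ.left_inv hy.2.1⟩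
    refine (measure_mono hsub).trans_lt ?_
    refine ((hK.mono inter_subset_left).hausdorffMeasure_image_le n.cast_nonneg).trans_lt ?_
    refine ENNReal.mul_lt_top (by simp) ((measure_mono inter_subset_right).trans_lt ?_)
    exact hausdorffMeasure_hyperplane_inter_ball_lt_top i _

/-! ### Monotonicity and Lipschitz perturbations -/

/-- The subdifferential is monotone. -/
theorem subdifferential_monotone {b : ℝ → ℝ≥0∞} {r₁ r₂ η₁ η₂ : ℝ}
    (h₁ : η₁ ∈ subdifferential b r₁) (h₂ : η₂ ∈ subdifferential b r₂) :
    0 ≤ (η₁ - η₂) * (r₁ - r₂) := by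
  obtain ⟨t₁, h₁⟩ := h₁
  obtain ⟨t₂, h₂⟩ := h₂
  have e₁ := h₁ r₂
  have e₂ := h₂ r₁
  lift b r₁ to ℝ≥0 using t₁ with p₁
  lift b r₂ to ℝ≥0 using t₂ with p₂
  have e₁' : (p₁ : ℝ) + η₁ * (r₂ - r₁) ≤ p₂ := by
    rw [EReal.coe_nnreal_eq_coe_real, EReal.coe_nnreal_eq_coe_real] at e₁
    exact_mod_cast e₁
  have e₂' : (p₂ : ℝ) + η₂ * (r₁ - r₂) ≤ p₁ := by
    rw [EReal.coe_nnreal_eq_coe_real, EReal.coe_nnreal_eq_coe_real] at e₂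
    exact_mod_cast e₂
  linarith

theorem memLp_lipschitz_comp {α : Type*} [MeasurableSpace α] {μ : Measure α} [IsFiniteMeasure μ]
    {L : ℝ≥0} {π : ℝ → ℝ} (hπ : LipschitzWith L π) {w : α → ℝ} (hw : MemLp w 2 μ) :
    MemLp (fun x => π (w x)) 2 μ := by
  have h : MemLp (fun x => π (w x) - π 0) 2 μ := by
    refine hw.of_le_mul (c := L)
      ((hπ.continuous.comp_aestronglyMeasurable hw.1).sub aestronglyMeasurable_const)
      (ae_of_all _ fun x => ?_)
    simpa using hπ.norm_sub_le (w x) 0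
  simpa [Pi.add_def] using h.add (memLp_const (π 0))

/-- The contribution of the nonlinear terms and of the right-hand sides to the difference of two
equations, tested with the difference of the solutions. -/
theorem integral_nonlinearity_sub_le {α : Type*} [MeasurableSpace α] {μ : Measure α}
    [IsFiniteMeasure μ] {L : ℝ≥0} {b : ℝ → ℝ≥0∞} {π : ℝ → ℝ} (hπ : LipschitzWith L π)
    {w₁ w₂ ξ₁ ξ₂ f₁ f₂ : Lp ℝ 2 μ} (h₁ : ∀ᵐ x ∂μ, ξ₁ x ∈ subdifferential b (w₁ x))
    (h₂ : ∀ᵐ x ∂μ, ξ₂ x ∈ subdifferential b (w₂ x)) :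
    ((∫ x, f₁ x * (w₁ - w₂) x ∂μ) - ∫ x, (ξ₁ x + π (w₁ x)) * (w₁ - w₂) x ∂μ)
      - ((∫ x, f₂ x * (w₁ - w₂) x ∂μ) - ∫ x, (ξ₂ x + π (w₂ x)) * (w₁ - w₂) x ∂μ)
    ≤ (L + 1 / 2) * ‖w₁ - w₂‖ ^ 2 + 1 / 2 * ‖f₁ - f₂‖ ^ 2 := by
  have hw := Lp.memLp (w₁ - w₂)
  have i : ∀ f : Lp ℝ 2 μ, Integrable (fun x => f x * (w₁ - w₂) x) μ := fun f =>
    (Lp.memLp f).integrable_mul hw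
  have j : ∀ f w : Lp ℝ 2 μ, Integrable (fun x => (f x + π (w x)) * (w₁ - w₂) x) μ := fun f w =>
    ((Lp.memLp f).add (memLp_lipschitz_comp hπ (Lp.memLp w))).integrable_mul hw
  have ij : ∀ f g w : Lp ℝ 2 μ,
      Integrable (fun x => f x * (w₁ - w₂) x - (g x + π (w x)) * (w₁ - w₂) x) μ := fun f g w =>
    (i f).sub (j g w)
  have nsq : ∀ w : Lp ℝ 2 μ, ‖w‖ ^ 2 = ∫ x, w x ^ 2 ∂μ := fun w => by
    rw [← real_inner_self_eq_norm_sq, L2.inner_def]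
    simp [sq]
  have sqi : ∀ w : Lp ℝ 2 μ, Integrable (fun x => w x ^ 2) μ := fun w => (Lp.memLp w).integrable_sq
  rw [← integral_sub (i _) (j _ _), ← integral_sub (i _) (j _ _),
    ← integral_sub (ij _ _ _) (ij _ _ _), nsq, nsq, ← integral_const_mul,
    ← integral_const_mul, ← integral_add ((sqi _).const_mul _) ((sqi _).const_mul _)]
  refine integral_mono_ae ((ij _ _ _).sub (ij _ _ _))
    (((sqi _).const_mul _).add ((sqi _).const_mul _)) ?_
  filter_upwards [h₁, h₂, Lp.coeFn_sub w₁ w₂, Lp.coeFn_sub f₁ f₂] with x k₁ k₂ k₃ k₄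
  simp only [k₃, k₄, Pi.sub_apply]
  have m := subdifferential_monotone k₁ k₂
  have l : -(L * (w₁ x - w₂ x) ^ 2) ≤ (π (w₁ x) - π (w₂ x)) * (w₁ x - w₂ x) := by
    have h := hπ.norm_sub_le (w₁ x) (w₂ x)
    have h' := neg_abs_le ((π (w₁ x) - π (w₂ x)) * (w₁ x - w₂ x))
    rw [abs_mul] at h'
    rw [Real.norm_eq_abs, Real.norm_eq_abs] at h
    have := mul_le_mul_of_nonneg_right h (abs_nonneg (w₁ x - w₂ x))
    nlinarith [sq_abs (w₁ x - w₂ x)]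
  nlinarith [sq_nonneg (f₁ x - f₂ x - (w₁ x - w₂ x))]

/-! ### Test functions -/

theorem traceGraph_sub_mem {d : ℕ} {Ω : Set (EuclideanSpace ℝ (Fin d))} {p q : V Ω × HΓ Ω}
    (hp : p ∈ traceGraph Ω) (hq : q ∈ traceGraph Ω) : p - q ∈ traceGraph Ω := by
  refine map_mem_closure₂ continuous_sub hp hq ?_
  rintro ⟨a, a'⟩ ⟨φ, h1, h2, h3⟩ ⟨c, c'⟩ ⟨χ, k1, k2, k3⟩
  refine ⟨fun x => φ x - χ x, h1.sub k1, ?_, ?_⟩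
  · change V.toH (a - c) =ᵐ[_] _
    rw [map_sub]
    filter_upwards [Lp.coeFn_sub (V.toH a) (V.toH c), h2, k2] with x e1 e2 e3
    rw [e1, Pi.sub_apply, e2, e3]
  · change (a' - c' : HΓ Ω) =ᵐ[_] _
    filter_upwards [Lp.coeFn_sub a' c', h3, k3] with x e1 e2 e3
    rw [e1, Pi.sub_apply, e2, e3]

theorem calV_sub_mem {d : ℕ} {Ω : Set (EuclideanSpace ℝ (Fin d))} {p q : V Ω × VΓ Ω}
    (hp : p ∈ calV Ω) (hq : q ∈ calV Ω) : p - q ∈ calV Ω := by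
  have := traceGraph_sub_mem hp hq
  change (p.1 - q.1, VΓ.toH (p.2 - q.2)) ∈ traceGraph Ω
  rw [map_sub]
  exact this

/-! ### The difference of two solutions -/

theorem HasWeakTimeDeriv.pivot_sub {X Y : Type*} [NormedAddCommGroup X] [NormedSpace ℝ X]
    [NormedAddCommGroup Y] [InnerProductSpace ℝ Y] {i : X →L[ℝ] Y} {T : ℝ} {g₁ g₂ : ℝ → X}
    {g₁' g₂' : ℝ → StrongDual ℝ X} (h₁ : HasWeakTimeDeriv T (fun t => pivot i (g₁ t)) g₁')
    (h₂ : HasWeakTimeDeriv T (fun t => pivot i (g₂ t)) g₂') (m₁ : IsL2 T g₁) (m₂ : IsL2 T g₂)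
    (m₁' : IsL2 T g₁') (m₂' : IsL2 T g₂') :
    HasWeakTimeDeriv T (fun t => pivot i (g₁ t - g₂ t)) (fun t => g₁' t - g₂' t) := by
  intro φ hφ hφc hφs
  let q : X →L[ℝ] StrongDual ℝ X :=
    (((ContinuousLinearMap.compL ℝ X Y ℝ).flip i).comp (innerSL ℝ)).comp i
  have hq : ∀ x, q x = pivot i x := fun x => rfl
  have a1 : MemLp φ 2 (timeMeasure T) := hφ.continuous.memLp_of_hasCompactSupport hφc
  have a2 : MemLp (deriv φ) 2 (timeMeasure T) :=
    (hφ.continuous_deriv (by simp)).memLp_of_hasCompactSupport hφc.deriv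
  have b1 : ∀ g : ℝ → StrongDual ℝ X, IsL2 T g →
      Integrable (fun t => φ t • g t) (timeMeasure T) :=
    fun g hg => memLp_one_iff_integrable.mp (hg.smul a1)
  have b2 : ∀ g : ℝ → X, IsL2 T g →
      Integrable (fun t => deriv φ t • q (g t)) (timeMeasure T) :=
    fun g hg => memLp_one_iff_integrable.mp ((q.comp_memLp' hg).smul a2)
  have e1 := h₁ φ hφ hφc hφs
  have e2 := h₂ φ hφ hφc hφs
  simp only [← hq] at e1 e2 ⊢
  simp only [map_sub, smul_sub]
  rw [integral_sub (b2 _ m₁) (b2 _ m₂), integral_sub (b1 _ m₁') (b1 _ m₂'), e1, e2]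
  abel

/-- The difference of the variational equations at a fixed time, tested with the difference of
the solutions. -/
theorem dissipation_le {d : ℕ} {Ω : Set (EuclideanSpace ℝ (Fin d))}
    [IsFiniteMeasure (volume.restrict Ω)] [IsFiniteMeasure (surfaceMeasure Ω)]
    {ν : ℝ} {L LΓ : ℝ≥0} {b bΓ : ℝ → ℝ≥0∞} {π πΓ : ℝ → ℝ}
    (hπ : LipschitzWith L π) (hπΓ : LipschitzWith LΓ πΓ) {f₁ f₂ ξ₁ ξ₂ : H Ω}
    {fΓ₁ fΓ₂ ξΓ₁ ξΓ₂ : HΓ Ω} {u₁ u₂ : V Ω} {v₁ v₂ : VΓ Ω} {u₁' u₂' : StrongDual ℝ (V Ω)}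
    {v₁' v₂' : StrongDual ℝ (VΓ Ω)} (t₁ : (u₁, v₁) ∈ calV Ω) (t₂ : (u₂, v₂) ∈ calV Ω)
    (k₁ : ∀ᵐ x ∂volume.restrict Ω, ξ₁ x ∈ subdifferential b (V.toH u₁ x))
    (k₂ : ∀ᵐ x ∂volume.restrict Ω, ξ₂ x ∈ subdifferential b (V.toH u₂ x))
    (l₁ : ∀ᵐ x ∂surfaceMeasure Ω, ξΓ₁ x ∈ subdifferential bΓ (VΓ.toH v₁ x))
    (l₂ : ∀ᵐ x ∂surfaceMeasure Ω, ξΓ₂ x ∈ subdifferential bΓ (VΓ.toH v₂ x))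
    (e₁ : ∀ z ∈ calV Ω,
      u₁' z.1 + (∫ x in Ω, inner ℝ (V.grad u₁ x) (V.grad z.1 x))
        + (∫ x in Ω, (ξ₁ x + π (V.toH u₁ x)) * V.toH z.1 x) + v₁' z.2
        + ν * (∫ x, inner ℝ (VΓ.grad v₁ x) (VΓ.grad z.2 x) ∂surfaceMeasure Ω)
        + (∫ x, (ξΓ₁ x + πΓ (VΓ.toH v₁ x)) * VΓ.toH z.2 x ∂surfaceMeasure Ω)
      = (∫ x in Ω, f₁ x * V.toH z.1 x) + (∫ x, fΓ₁ x * VΓ.toH z.2 x ∂surfaceMeasure Ω))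
    (e₂ : ∀ z ∈ calV Ω,
      u₂' z.1 + (∫ x in Ω, inner ℝ (V.grad u₂ x) (V.grad z.1 x))
        + (∫ x in Ω, (ξ₂ x + π (V.toH u₂ x)) * V.toH z.1 x) + v₂' z.2
        + ν * (∫ x, inner ℝ (VΓ.grad v₂ x) (VΓ.grad z.2 x) ∂surfaceMeasure Ω)
        + (∫ x, (ξΓ₂ x + πΓ (VΓ.toH v₂ x)) * VΓ.toH z.2 x ∂surfaceMeasure Ω)
      = (∫ x in Ω, f₂ x * V.toH z.1 x) + (∫ x, fΓ₂ x * VΓ.toH z.2 x ∂surfaceMeasure Ω)) :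
    (u₁' - u₂') (u₁ - u₂) + (v₁' - v₂') (v₁ - v₂) + ‖V.grad (u₁ - u₂)‖ ^ 2
        + ν * ‖VΓ.grad (v₁ - v₂)‖ ^ 2
      ≤ (L + 1 / 2) * ‖V.toH (u₁ - u₂)‖ ^ 2 + 1 / 2 * ‖f₁ - f₂‖ ^ 2
        + ((LΓ + 1 / 2) * ‖VΓ.toH (v₁ - v₂)‖ ^ 2 + 1 / 2 * ‖fΓ₁ - fΓ₂‖ ^ 2) := by
  have hz := calV_sub_mem t₁ t₂
  have h₁ := e₁ _ hz
  have h₂ := e₂ _ hz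
  have b₁ := integral_nonlinearity_sub_le hπ (f₁ := f₁) (f₂ := f₂) k₁ k₂
  have b₂ := integral_nonlinearity_sub_le hπΓ (f₁ := fΓ₁) (f₂ := fΓ₂) l₁ l₂
  simp only [← L2.inner_def] at h₁ h₂
  have g₁ : ‖V.grad (u₁ - u₂)‖ ^ 2
      = inner ℝ (V.grad u₁) (V.grad (u₁ - u₂)) - inner ℝ (V.grad u₂) (V.grad (u₁ - u₂)) := by
    rw [← inner_sub_left, ← map_sub, real_inner_self_eq_norm_sq]
  have g₂ : ‖VΓ.grad (v₁ - v₂)‖ ^ 2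
      = inner ℝ (VΓ.grad v₁) (VΓ.grad (v₁ - v₂)) - inner ℝ (VΓ.grad v₂) (VΓ.grad (v₁ - v₂)) := by
    rw [← inner_sub_left, ← map_sub, real_inner_self_eq_norm_sq]
  simp only [Prod.fst_sub, Prod.snd_sub] at h₁ h₂
  rw [← map_sub] at b₁ b₂
  rw [g₁, g₂, sub_apply, sub_apply]
  linarith

/-! ### Norms in time and the energy estimate -/

theorem eLpNorm_two_sq {α E : Type*} [MeasurableSpace α] {μ : Measure α} [NormedAddCommGroup E]
    {g : α → E} (hg : MemLp g 2 μ) :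
    eLpNorm g 2 μ ^ 2 = ENNReal.ofReal (∫ t, ‖g t‖ ^ 2 ∂μ) := by
  rw [hg.eLpNorm_eq_integral_rpow_norm (by norm_num) (by norm_num),
    ← ENNReal.ofReal_pow (by positivity)]
  congr 1
  simp only [ENNReal.toReal_ofNat, Real.rpow_ofNat]
  rw [← Real.rpow_natCast, ← Real.rpow_mul (integral_nonneg fun t => by positivity)]
  norm_num

theorem eLpNorm_top_sq_le {α E : Type*} [MeasurableSpace α] {μ : Measure α}
    [NormedAddCommGroup E] {g : α → E} {C : ℝ} (hC : 0 ≤ C) (hg : ∀ᵐ t ∂μ, ‖g t‖ ^ 2 ≤ C) :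
    eLpNorm g ⊤ μ ^ 2 ≤ ENNReal.ofReal C := by
  have h : eLpNorm g ⊤ μ ≤ ENNReal.ofReal √C := by
    rw [eLpNorm_exponent_top]
    exact eLpNormEssSup_le_of_ae_bound (hg.mono fun t ht => Real.le_sqrt_of_sq_le ht)
  calc eLpNorm g ⊤ μ ^ 2 ≤ ENNReal.ofReal √C ^ 2 := by gcongr
    _ = ENNReal.ofReal C := by rw [← ENNReal.ofReal_pow (by positivity), Real.sq_sqrt hC]

/-- Gronwall's lemma for an energy `y` with dissipation `D` and forcing `F`. -/
theorem energy_gronwall {y D F : ℝ → ℝ} {T K : ℝ} (hT : 0 < T) (hK : 0 ≤ K)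
    (hy : ContinuousOn y (Icc 0 T)) (hy0 : ∀ t, 0 ≤ y t) (hD0 : ∀ t, 0 ≤ D t)
    (hF : IntegrableOn F (Ioo 0 T)) (hF0 : ∀ t, 0 ≤ F t)
    (h : ∀ b ∈ Ioc 0 T, y b + 2 * (∫ t in Ioo 0 b, D t)
      ≤ y 0 + K * (∫ t in Ioo 0 b, y t) + ∫ t in Ioo 0 b, F t) :
    (∀ t ∈ Icc 0 T, y t ≤ (y 0 + ∫ t in Ioo 0 T, F t) * Real.exp (K * T)) ∧
      ∫ t in Ioo 0 T, D t
        ≤ (y 0 + ∫ t in Ioo 0 T, F t) * (1 + K * T * Real.exp (K * T)) := by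
  set A := y 0 + ∫ t in Ioo 0 T, F t with hA
  have hFT : 0 ≤ ∫ t in Ioo 0 T, F t := integral_nonneg hF0
  have hA0 : 0 ≤ A := add_nonneg (hy0 0) hFT
  have hDb : ∀ b, 0 ≤ ∫ t in Ioo 0 b, D t := fun b => integral_nonneg hD0
  have h1 : ∀ t ∈ Icc 0 T, y t ≤ A * Real.exp (K * T) := by
    intro t ht
    have := le_mul_exp_of_le_add_integral (A := A) hy hK (fun b hb => ?_) t ht
    · exact this.trans (by have := ht.2; gcongr)
    · rcases hb.1.eq_or_lt with rfl | hb0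
      · simpa [hA] using hFT
      · have hFb : ∫ t in Ioo 0 b, F t ≤ ∫ t in Ioo 0 T, F t :=
          setIntegral_mono_set hF (ae_of_all _ hF0) (Ioo_subset_Ioo_right hb.2).eventuallyLE
        have := h b ⟨hb0, hb.2⟩
        rw [intervalIntegral.integral_of_le hb.1, integral_Ioc_eq_integral_Ioo]
        linarith [hDb b]
  refine ⟨h1, ?_⟩
  have h2 := h T ⟨hT, le_rfl⟩
  have h3 : ∫ t in Ioo 0 T, y t ≤ T * (A * Real.exp (K * T)) := by
    calc ∫ t in Ioo 0 T, y t ≤ ∫ t in Ioo 0 T, A * Real.exp (K * T) :=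
          setIntegral_mono_on (hy.integrableOn_Icc.mono_set Ioo_subset_Icc_self)
            (integrable_const _) measurableSet_Ioo fun t ht => h1 t (Ioo_subset_Icc_self ht)
      _ = T * (A * Real.exp (K * T)) := by simp [hT.le]
  have h4 := mul_le_mul_of_nonneg_left h3 hK
  have h5 := hDb T
  have h6 := hy0 T
  calc ∫ t in Ioo 0 T, D t ≤ A + K * (T * (A * Real.exp (K * T))) := by linarith
    _ = A * (1 + K * T * Real.exp (K * T)) := by ring

/-- The energy estimate for the difference of two weak solutions, in terms of the continuous
representatives `h`, `k` of `u₁ - u₂` and `v₁ - v₂`. -/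
theorem IsWeakSolution.energy_sub {d : ℕ} {Ω : Set (EuclideanSpace ℝ (Fin d))}
    [IsFiniteMeasure (volume.restrict Ω)] [IsFiniteMeasure (surfaceMeasure Ω)]
    {T ν : ℝ} {L LΓ : ℝ≥0} {b bΓ : ℝ → ℝ≥0∞} {π πΓ : ℝ → ℝ}
    (hπ : LipschitzWith L π) (hπΓ : LipschitzWith LΓ πΓ)
    {f₁ f₂ ξ₁ ξ₂ : ℝ → H Ω} {fΓ₁ fΓ₂ ξΓ₁ ξΓ₂ : ℝ → HΓ Ω} {u₀₁ u₀₂ : H Ω} {v₀₁ v₀₂ : HΓ Ω}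
    {u₁ u₂ : ℝ → V Ω} {v₁ v₂ : ℝ → VΓ Ω}
    (hf₁ : IsL2 T f₁) (hf₂ : IsL2 T f₂) (hfΓ₁ : IsL2 T fΓ₁) (hfΓ₂ : IsL2 T fΓ₂)
    (s₁ : IsWeakSolution Ω T ν b bΓ π πΓ f₁ fΓ₁ u₀₁ v₀₁ u₁ v₁ ξ₁ ξΓ₁)
    (s₂ : IsWeakSolution Ω T ν b bΓ π πΓ f₂ fΓ₂ u₀₂ v₀₂ u₂ v₂ ξ₂ ξΓ₂)
    {h : ℝ → H Ω} {k : ℝ → HΓ Ω} (hc : ContinuousOn h (Icc 0 T)) (kc : ContinuousOn k (Icc 0 T))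
    (hh : h =ᵐ[timeMeasure T] fun t => V.toH (u₁ t - u₂ t))
    (hk : k =ᵐ[timeMeasure T] fun t => VΓ.toH (v₁ t - v₂ t)) {c : ℝ} (hcT : c ∈ Ioc 0 T) :
    ‖h c‖ ^ 2 + ‖k c‖ ^ 2 + 2 * (∫ t in Ioo 0 c,
        (‖V.grad (u₁ t - u₂ t)‖ ^ 2 + ν * ‖VΓ.grad (v₁ t - v₂ t)‖ ^ 2))
      ≤ ‖h 0‖ ^ 2 + ‖k 0‖ ^ 2
        + (2 * (L + LΓ) + 1) * (∫ t in Ioo 0 c, (‖h t‖ ^ 2 + ‖k t‖ ^ 2))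
        + ∫ t in Ioo 0 c, (‖f₁ t - f₂ t‖ ^ 2 + ‖fΓ₁ t - fΓ₂ t‖ ^ 2) := by
  obtain ⟨u₁', v₁', mu₁, wu₁, mv₁, wv₁, eq₁⟩ := s₁.equation
  obtain ⟨u₂', v₂', mu₂, wu₂, mv₂, wv₂, eq₂⟩ := s₂.equation
  have mu : IsL2 T fun t => u₁ t - u₂ t := s₁.isL2_u.sub s₂.isL2_u
  have mv : IsL2 T fun t => v₁ t - v₂ t := s₁.isL2_v.sub s₂.isL2_v
  have mu' : IsL2 T fun t => u₁' t - u₂' t := mu₁.sub mu₂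
  have mv' : IsL2 T fun t => v₁' t - v₂' t := mv₁.sub mv₂
  have Eu := energy_inequality V.toH mu mu'
    (wu₁.pivot_sub wu₂ s₁.isL2_u s₂.isL2_u mu₁ mu₂) hc hh hcT
  have Ev := energy_inequality VΓ.toH mv mv'
    (wv₁.pivot_sub wv₂ s₁.isL2_v s₂.isL2_v mv₁ mv₂) kc hk hcT
  have hmono : volume.restrict (Ioo 0 c) ≤ timeMeasure T :=
    Measure.restrict_mono (Ioo_subset_Ioo_right hcT.2) le_rfl
  have iu : IntegrableOn (fun t => (u₁' t - u₂' t) (u₁ t - u₂ t)) (Ioo 0 c) :=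
    memLp_one_iff_integrable.mp ((ContinuousLinearMap.id ℝ (StrongDual ℝ (V Ω))).memLp_of_bilin 1
      (mu'.mono_measure hmono) (mu.mono_measure hmono))
  have iv : IntegrableOn (fun t => (v₁' t - v₂' t) (v₁ t - v₂ t)) (Ioo 0 c) :=
    memLp_one_iff_integrable.mp ((ContinuousLinearMap.id ℝ (StrongDual ℝ (VΓ Ω))).memLp_of_bilin 1
      (mv'.mono_measure hmono) (mv.mono_measure hmono))
  have igu : IntegrableOn (fun t => ‖V.grad (u₁ t - u₂ t)‖ ^ 2) (Ioo 0 c) :=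
    ((V.grad.comp_memLp' mu).mono_measure hmono).integrable_norm_pow (by norm_num)
  have igv : IntegrableOn (fun t => ‖VΓ.grad (v₁ t - v₂ t)‖ ^ 2) (Ioo 0 c) :=
    ((VΓ.grad.comp_memLp' mv).mono_measure hmono).integrable_norm_pow (by norm_num)
  have ify : IntegrableOn (fun t => ‖h t‖ ^ 2 + ‖k t‖ ^ 2) (Ioo 0 c) :=
    (((hc.norm.pow 2).add (kc.norm.pow 2)).integrableOn_Icc).mono_set
      (Ioo_subset_Icc_self.trans (Icc_subset_Icc_right hcT.2))
  have idf : IntegrableOn (fun t => ‖f₁ t - f₂ t‖ ^ 2 + ‖fΓ₁ t - fΓ₂ t‖ ^ 2) (Ioo 0 c) :=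
    (((hf₁.sub hf₂).mono_measure hmono).integrable_norm_pow (by norm_num)).add
      (((hfΓ₁.sub hfΓ₂).mono_measure hmono).integrable_norm_pow (by norm_num))
  have key : (∫ t in Ioo 0 c, (u₁' t - u₂' t) (u₁ t - u₂ t))
      + (∫ t in Ioo 0 c, (v₁' t - v₂' t) (v₁ t - v₂ t))
      + (∫ t in Ioo 0 c, (‖V.grad (u₁ t - u₂ t)‖ ^ 2 + ν * ‖VΓ.grad (v₁ t - v₂ t)‖ ^ 2))
      ≤ (L + LΓ + 1 / 2) * (∫ t in Ioo 0 c, (‖h t‖ ^ 2 + ‖k t‖ ^ 2))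
        + 1 / 2 * ∫ t in Ioo 0 c, (‖f₁ t - f₂ t‖ ^ 2 + ‖fΓ₁ t - fΓ₂ t‖ ^ 2) := by
    have ig : IntegrableOn (fun t => ‖V.grad (u₁ t - u₂ t)‖ ^ 2
        + ν * ‖VΓ.grad (v₁ t - v₂ t)‖ ^ 2) (Ioo 0 c) := igu.add (igv.const_mul ν)
    have iuv : IntegrableOn (fun t => (u₁' t - u₂' t) (u₁ t - u₂ t)
        + (v₁' t - v₂' t) (v₁ t - v₂ t)) (Ioo 0 c) := iu.add iv
    rw [← integral_add iu iv, ← integral_add iuv ig, ← integral_const_mul, ← integral_const_mul,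
      ← integral_add (ify.const_mul _) (idf.const_mul _)]
    refine integral_mono_ae (iuv.add ig) ((ify.const_mul _).add (idf.const_mul _)) ?_
    refine ae_mono hmono ?_
    filter_upwards [eq₁, eq₂, s₁.trace, s₂.trace, s₁.ξ_mem, s₂.ξ_mem, s₁.ξΓ_mem, s₂.ξΓ_mem, hh, hk]
      with t e₁ e₂ t₁ t₂ k₁ k₂ l₁ l₂ ht kt
    have := dissipation_le hπ hπΓ t₁ t₂ k₁ k₂ l₁ l₂ e₁ e₂
    rw [← ht, ← kt] at this
    -- the one constant `L + LΓ` covers both terms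
    have p₁ := mul_nonneg LΓ.coe_nonneg (sq_nonneg ‖h t‖)
    have p₂ := mul_nonneg L.coe_nonneg (sq_nonneg ‖k t‖)
    change _ + _ ≤ _
    linarith
  linarith

end AllenCahn


/-! ### Continuous dependence -/

theorem mainTheorem1 {d : ℕ} (hd : 1 < d) (Ω : Set (EuclideanSpace ℝ (Fin d)))
    (hΩ : AllenCahn.IsSmoothBoundedDomain Ω) (T : ℝ) (hT : 0 < T) (L LΓ : ℝ≥0) :
    ∃ c : ℝ≥0, ∀ (ν : ℝ), 0 < ν →
      ∀ (b bΓ : ℝ → ℝ≥0∞), AllenCahn.IsConvexPotential b → AllenCahn.IsConvexPotential bΓ →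
      ∀ (π πΓ : ℝ → ℝ), LipschitzWith L π → LipschitzWith LΓ πΓ →
      ∀ (f₁ f₂ : ℝ → AllenCahn.H Ω) (fΓ₁ fΓ₂ : ℝ → AllenCahn.HΓ Ω),
        AllenCahn.IsL2 T f₁ → AllenCahn.IsL2 T f₂ →
        AllenCahn.IsL2 T fΓ₁ → AllenCahn.IsL2 T fΓ₂ →
      ∀ (u₀₁ u₀₂ : AllenCahn.H Ω) (v₀₁ v₀₂ : AllenCahn.HΓ Ω)
        (u₁ u₂ : ℝ → AllenCahn.V Ω) (v₁ v₂ : ℝ → AllenCahn.VΓ Ω)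
        (ξ₁ ξ₂ : ℝ → AllenCahn.H Ω) (ξΓ₁ ξΓ₂ : ℝ → AllenCahn.HΓ Ω),
        AllenCahn.IsWeakSolution Ω T ν b bΓ π πΓ f₁ fΓ₁ u₀₁ v₀₁ u₁ v₁ ξ₁ ξΓ₁ →
        AllenCahn.IsWeakSolution Ω T ν b bΓ π πΓ f₂ fΓ₂ u₀₂ v₀₂ u₂ v₂ ξ₂ ξΓ₂ →
        eLpNorm (fun t => AllenCahn.V.toH (u₁ t - u₂ t)) ⊤ (AllenCahn.timeMeasure T) ^ 2
          + eLpNorm (fun t => AllenCahn.V.grad (u₁ t - u₂ t)) 2 (AllenCahn.timeMeasure T) ^ 2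
          + eLpNorm (fun t => AllenCahn.VΓ.toH (v₁ t - v₂ t)) ⊤ (AllenCahn.timeMeasure T) ^ 2
          + ENNReal.ofReal ν *
            eLpNorm (fun t => AllenCahn.VΓ.grad (v₁ t - v₂ t)) 2 (AllenCahn.timeMeasure T) ^ 2
        ≤ (c : ℝ≥0∞) * (‖u₀₁ - u₀₂‖ₑ ^ 2 + ‖v₀₁ - v₀₂‖ₑ ^ 2
          + eLpNorm (fun t => f₁ t - f₂ t) 2 (AllenCahn.timeMeasure T) ^ 2
          + eLpNorm (fun t => fΓ₁ t - fΓ₂ t) 2 (AllenCahn.timeMeasure T) ^ 2) := by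

  have : IsFiniteMeasure (volume.restrict Ω) :=
    ⟨by rw [Measure.restrict_apply_univ]; exact hΩ.isBounded.measure_lt_top⟩
  have := hΩ.isFiniteMeasure_surfaceMeasure hd
  let K : ℝ := 2 * (L + LΓ) + 1
  have hK : 0 ≤ K := by positivity
  have hKT : 0 ≤ K * T := mul_nonneg hK hT.le
  let C : ℝ := 2 * Real.exp (K * T) + (1 + K * T * Real.exp (K * T))
  have hC : 0 ≤ C := by positivity
  -- two suprema, each at most `A exp (K T)`, and the bound of `energy_gronwall` for the dissipation
  refine ⟨C.toNNReal, ?_⟩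
  intro ν hν b bΓ _ _ π πΓ hπ hπΓ f₁ f₂ fΓ₁ fΓ₂ hf₁ hf₂ hfΓ₁ hfΓ₂ u₀₁ u₀₂ v₀₁ v₀₂
    u₁ u₂ v₁ v₂ ξ₁ ξ₂ ξΓ₁ ξΓ₂ s₁ s₂
  obtain ⟨h₁, hc₁, hh₁, hz₁⟩ := s₁.initial_u
  obtain ⟨h₂, hc₂, hh₂, hz₂⟩ := s₂.initial_u
  obtain ⟨k₁, kc₁, hk₁, kz₁⟩ := s₁.initial_v
  obtain ⟨k₂, kc₂, hk₂, kz₂⟩ := s₂.initial_v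
  have hc := hc₁.sub hc₂
  have kc := kc₁.sub kc₂
  have hh : h₁ - h₂ =ᵐ[AllenCahn.timeMeasure T] fun t => AllenCahn.V.toH (u₁ t - u₂ t) := by
    filter_upwards [hh₁, hh₂] with t e₁ e₂
    rw [Pi.sub_apply, e₁, e₂, map_sub]
  have hk : k₁ - k₂ =ᵐ[AllenCahn.timeMeasure T] fun t => AllenCahn.VΓ.toH (v₁ t - v₂ t) := by
    filter_upwards [hk₁, hk₂] with t e₁ e₂
    rw [Pi.sub_apply, e₁, e₂, map_sub]
  have mu := s₁.isL2_u.sub s₂.isL2_u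
  have mv := s₁.isL2_v.sub s₂.isL2_v
  have mgu : AllenCahn.IsL2 T fun t => AllenCahn.V.grad (u₁ t - u₂ t) :=
    AllenCahn.V.grad.comp_memLp' mu
  have mgv : AllenCahn.IsL2 T fun t => AllenCahn.VΓ.grad (v₁ t - v₂ t) :=
    AllenCahn.VΓ.grad.comp_memLp' mv
  have mf : AllenCahn.IsL2 T fun t => f₁ t - f₂ t := hf₁.sub hf₂
  have mfΓ : AllenCahn.IsL2 T fun t => fΓ₁ t - fΓ₂ t := hfΓ₁.sub hfΓ₂
  have igu := mgu.integrable_norm_pow (p := 2) (by norm_num)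
  have igv := mgv.integrable_norm_pow (p := 2) (by norm_num)
  have iF := mf.integrable_norm_pow (p := 2) (by norm_num)
  have iFΓ := mfΓ.integrable_norm_pow (p := 2) (by norm_num)
  have iFF : IntegrableOn (fun t => ‖f₁ t - f₂ t‖ ^ 2 + ‖fΓ₁ t - fΓ₂ t‖ ^ 2) (Ioo 0 T) :=
    iF.add iFΓ
  obtain ⟨g1, g2⟩ := AllenCahn.energy_gronwall
    (y := fun t => ‖(h₁ - h₂) t‖ ^ 2 + ‖(k₁ - k₂) t‖ ^ 2)
    (D := fun t => ‖AllenCahn.V.grad (u₁ t - u₂ t)‖ ^ 2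
      + ν * ‖AllenCahn.VΓ.grad (v₁ t - v₂ t)‖ ^ 2)
    (F := fun t => ‖f₁ t - f₂ t‖ ^ 2 + ‖fΓ₁ t - fΓ₂ t‖ ^ 2) hT hK
    ((hc.norm.pow 2).add (kc.norm.pow 2)) (fun t => by positivity) (fun t => by positivity)
    iFF (fun t => by positivity)
    fun c hcT => s₁.energy_sub hπ hπΓ hf₁ hf₂ hfΓ₁ hfΓ₂ s₂ hc kc hh hk hcT
  rw [integral_add igu (igv.const_mul ν), integral_const_mul] at g2
  simp only [Pi.sub_apply, hz₁, hz₂, kz₁, kz₂] at g1 g2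
  set A : ℝ := ‖u₀₁ - u₀₂‖ ^ 2 + ‖v₀₁ - v₀₂‖ ^ 2
    + ∫ t in Ioo 0 T, (‖f₁ t - f₂ t‖ ^ 2 + ‖fΓ₁ t - fΓ₂ t‖ ^ 2) with hA
  have hA0 : 0 ≤ A := add_nonneg (by positivity) (integral_nonneg fun t => by positivity)
  have hAe : 0 ≤ A * Real.exp (K * T) := by positivity
  have hIcc : ∀ᵐ t ∂AllenCahn.timeMeasure T, t ∈ Icc 0 T :=
    (ae_restrict_mem measurableSet_Ioo).mono fun t ht => Ioo_subset_Icc_self ht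
  have n1 := AllenCahn.eLpNorm_top_sq_le (μ := AllenCahn.timeMeasure T)
    (g := fun t => AllenCahn.V.toH (u₁ t - u₂ t)) hAe (by
      filter_upwards [hh, hIcc] with t e ht
      rw [← e]
      exact (le_add_of_nonneg_right (by positivity)).trans (g1 t ht))
  have n2 := AllenCahn.eLpNorm_top_sq_le (μ := AllenCahn.timeMeasure T)
    (g := fun t => AllenCahn.VΓ.toH (v₁ t - v₂ t)) hAe (by
      filter_upwards [hk, hIcc] with t e ht
      rw [← e]
      exact (le_add_of_nonneg_left (by positivity)).trans (g1 t ht))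
  have r1 : ‖u₀₁ - u₀₂‖ₑ ^ 2 + ‖v₀₁ - v₀₂‖ₑ ^ 2
      + eLpNorm (fun t => f₁ t - f₂ t) 2 (AllenCahn.timeMeasure T) ^ 2
      + eLpNorm (fun t => fΓ₁ t - fΓ₂ t) 2 (AllenCahn.timeMeasure T) ^ 2
      = ENNReal.ofReal A := by
    rw [AllenCahn.eLpNorm_two_sq mf, AllenCahn.eLpNorm_two_sq mfΓ, hA, integral_add iF iFΓ,
      ← ofReal_norm, ← ofReal_norm, ← ENNReal.ofReal_pow (norm_nonneg _),
      ← ENNReal.ofReal_pow (norm_nonneg _), ← ENNReal.ofReal_add (by positivity) (by positivity),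
      ← ENNReal.ofReal_add (by positivity) (integral_nonneg fun t => by positivity),
      ← ENNReal.ofReal_add (add_nonneg (by positivity) (integral_nonneg fun t => by positivity))
        (integral_nonneg fun t => by positivity), add_assoc _ (∫ t in Ioo 0 T, ‖f₁ t - f₂ t‖ ^ 2)]
  have hI1 : 0 ≤ ∫ t in Ioo 0 T, ‖AllenCahn.V.grad (u₁ t - u₂ t)‖ ^ 2 :=
    integral_nonneg fun t => by positivity
  have hI2 : 0 ≤ ∫ t in Ioo 0 T, ‖AllenCahn.VΓ.grad (v₁ t - v₂ t)‖ ^ 2 :=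
    integral_nonneg fun t => by positivity
  rw [r1, AllenCahn.eLpNorm_two_sq mgu, AllenCahn.eLpNorm_two_sq mgv, ENNReal.ofNNReal_toNNReal,
    ← ENNReal.ofReal_mul hC, ← ENNReal.ofReal_mul hν.le]
  refine (add_le_add_left (add_le_add (add_le_add_left n1 _) n2) _).trans ?_
  rw [← ENNReal.ofReal_add hAe hI1, ← ENNReal.ofReal_add (add_nonneg hAe hI1) hAe,
    ← ENNReal.ofReal_add (add_nonneg (add_nonneg hAe hI1) hAe) (mul_nonneg hν.le hI2)]
  refine ENNReal.ofReal_le_ofReal ?_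
  simp only [C]
  linarith
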